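/- Let $\mathbf N\in\mathbb C^{m\times n}$ have independent columns with the circular complex Gaussian distribution $\mathcal{CN}(\mathbf 0,\boldsymbol\Sigma_{\mathbf N})$, where $\boldsymbol\Sigma_{\mathbf N}$ is Hermitian positive definite and known. Let $\mathbf W=\mathbf W_n=\mathbf a_r\mathbf a_t^T\mathbf S_n\in\mathbb C^{m\times n}$ with known vectors $\mathbf a_r\in\mathbb C^m$, $\mathbf a_t\in\mathbb C^p$ and known $\mathbf S_n\in\mathbb C^{p\times n}$, and let $\mathbf w_1,\dots,\mathbf w_n$ be the columns of $\mathbf W_n$. The one-bit data are $\mathbf Y=\mathcal Q(\beta\mathbf W+\mathbf N)$ with $\mathcal Q(\mathbf X)=\operatorname{sign}(\operatorname{Re}\mathbf X)+\imath\operatorname{sign}(\operatorname{Im}\mathbf X)$ entrywise and $\beta=a+\imath b$ unknown; $\mathcal H_0$ is the hypothesis $\beta=0$. Assume that $\mathbf W_n\neq\mathbf 0$ for all large $n$ and that $$\frac{\max_{1\le i\le n}\|\mathbf w_i\|^2}{\sum_{k=1}^n\|\mathbf w_k\|^2}\longrightarrow 0\qquad(n\to\infty).$$ Write $\underline{\mathbf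 y}_i=[\operatorname{Re}(\mathbf y_i)^T,\operatorname{Im}(\mathbf y_i)^T]^T$ for the stacked columns of $\mathbf Y$, let $$\boldsymbol\Sigma_{\underline{\mathbf x}}=\frac12\begin{bmatrix}\operatorname{Re}\boldsymbol\Sigma_{\mathbf N}&-\operatorname{Im}\boldsymbol\Sigma_{\mathbf N}\\ \operatorname{Im}\boldsymbol\Sigma_{\mathbf N}&\operatorname{Re}\boldsymbol\Sigma_{\mathbf N}\end{bmatrix},$$ let $\mathbf D$ be the diagonal part of $\boldsymbol\Sigma_{\underline{\mathbf x}}$, $\mathbf C=\mathbf D^{-1/2}\boldsymbol\Sigma_{\underline{\mathbf x}}\mathbf D^{-1/2}$, and let $P(\boldsymbol\mu,\boldsymbol\Sigma)$ be the integral of the density of $\mathcal N(\boldsymbol\mu,\boldsymbol\Sigma)$ over the positive orthant. With $\boldsymbol\theta=[a,b]^T$ and $\mathbf Z_i=\operatorname{diag}(\underline{\mathbf y}_i)$, the log-likelihood of the data is $$\mathcal L(\mathbf Y;\boldsymbol\theta)=\sum_{i=1}^n\log P\!\left(\mathbf Z_i\mathbf D^{-1/2}\begin{bmatrix}\operatorname{Re}(\beta\mathbf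 w_i)\\ \operatorname{Im}(\beta\mathbf w_i)\end{bmatrix},\ \mathbf Z_i\mathbf C\mathbf Z_i\right),$$ and Rao's statistic is $T_{\rm R}=\mathbf g^T\mathbf F(\mathbf 0)^{-1}\mathbf g$, where $\mathbf g=\partial\mathcal L(\mathbf Y;\boldsymbol\theta)/\partial\boldsymbol\theta|_{\boldsymbol\theta=\mathbf 0}$ and $\mathbf F(\boldsymbol\theta)=\mathbb E_{\boldsymbol\theta}\big[\tfrac{\partial\mathcal L}{\partial\boldsymbol\theta}\tfrac{\partial\mathcal L}{\partial\boldsymbol\theta^T}\big]$ is the Fisher information matrix. Then, under $\mathcal H_0$, $T_{\rm R}$ converges in distribution, as $n\to\infty$, to the $\chi^2_2$ distribution, which is the exponential distribution with rate $1/2$. Consequently, the asymptotic probability of false alarm at every threshold $\gamma\ge0$ is $$P_{\rm fa}(\gamma)=\lim_{n\to\infty}\Pr\{T_{\rm R}>\gamma\mid\mathcal H_0\}=\exp(-\gamma/2),$$ and for every $P_{\rm fa}\in(0,1]$ the unique threshold $\gamma\ge0$ whose asymptotic probability of false alarm is $P_{\rm fa}$ is $\gamma=-2\log P_{\rm fa}$.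 -/

import Mathlib

open MeasureTheory ProbabilityTheory Filter Topology
open scoped Matrix ComplexOrder

noncomputable section

namespace OneBitRadar

/-- The noise-free response `W = a_r a_tᵀ S` to a unit reflectivity, where `a_r` and `a_t` are the
receive and transmit steering vectors at the angle under test and `S` is the probing signal. -/
def response {p m n : ℕ} (ar : Fin m → ℂ) (at' : Fin p → ℂ) (S : Matrix (Fin p) (Fin n) ℂ) :
    Matrix (Fin m) (Fin n) ℂ :=
  Matrix.vecMulVec ar at' * S

/-- The energy `‖w_i‖²` of the `i`-th column (snapshot) of `W`. -/
def energy {m n : ℕ} (W : Matrix (Fin m) (Fin n) ℂ) (i : Fin n) : ℝ :=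
  ∑ j, ‖W j i‖ ^ 2

/-- The complex one-bit quantizer, applied entrywise: `sign (Re x) + ı sign (Im x)`. -/
def quantize {m n : ℕ} (X : Matrix (Fin m) (Fin n) ℂ) : Matrix (Fin m) (Fin n) ℂ :=
  X.map fun z => (Real.sign z.re : ℂ) + (Real.sign z.im : ℂ) * Complex.I

/-- The real vector `[Re(x)ᵀ, Im(x)ᵀ]ᵀ` of a complex vector `x`. -/
def stack {m : ℕ} (x : Fin m → ℂ) : Fin m ⊕ Fin m → ℝ :=
  Sum.elim (fun j => (x j).re) (fun j => (x j).im)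

/-- The covariance matrix of the stacked vector of a circular complex Gaussian vector with
covariance matrix `K`. -/
def realCov {m : ℕ} (K : Matrix (Fin m) (Fin m) ℂ) :
    Matrix (Fin m ⊕ Fin m) (Fin m ⊕ Fin m) ℝ :=
  (1 / 2 : ℝ) • Matrix.fromBlocks (K.map Complex.re) (-K.map Complex.im)
    (K.map Complex.im) (K.map Complex.re)

/-- `Z` has the circular complex Gaussian distribution `𝒞𝒩(0, K)` under `μ`. -/
def IsCircularGaussian {m : ℕ} {Ω : Type*} [MeasurableSpace Ω] (Z : Ω → Fin m → ℂ)
    (K : Matrix (Fin m) (Fin m) ℂ) (μ : Measure Ω) : Prop :=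
  HasLaw (fun ω => WithLp.toLp 2 (stack (Z ω))) (multivariateGaussian 0 (realCov K)) μ

/-- The probability density function of the Gaussian distribution `𝒩(μ, C)`. -/
def gaussianDensity {ι : Type*} [Fintype ι] [DecidableEq ι] (μ : ι → ℝ) (C : Matrix ι ι ℝ)
    (x : ι → ℝ) : ℝ :=
  1 / ((2 * Real.pi) ^ ((Fintype.card ι : ℝ) / 2) * Real.sqrt C.det) *
    Real.exp (-(1 / 2) * ((x - μ) ⬝ᵥ (C⁻¹ *ᵥ (x - μ))))

/-- The orthant probability `P(μ, C)`. -/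
def orthantProb {ι : Type*} [Fintype ι] [DecidableEq ι] (μ : ι → ℝ) (C : Matrix ι ι ℝ) : ℝ :=
  ∫ x in Set.univ.pi fun _ => Set.Ioi (0 : ℝ), gaussianDensity μ C x

/-- The matrix `D^{-1/2}`, where `D` is the diagonal part of the covariance matrix `C`. -/
def invSqrtDiag {ι : Type*} [DecidableEq ι] (C : Matrix ι ι ℝ) : Matrix ι ι ℝ :=
  Matrix.diagonal fun j => 1 / Real.sqrt (C j j)

/-- The coherence matrix `D^{-1/2} C D^{-1/2}` of the covariance matrix `C`. -/
def coherence {ι : Type*} [Fintype ι] [DecidableEq ι] (C : Matrix ι ι ℝ) : Matrix ι ι ℝ :=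
  invSqrtDiag C * C * invSqrtDiag C

/-- The likelihood `P(Z ν, Z C Z)`, `Z = diag(y)`, of a single stacked one-bit sample
`y ∈ {±1}^{2m}`, when the noise covariance is `K`, the column of `W` is `w` and the
reflectivity is `θ₀ + ı θ₁`. -/
def sampleLikelihood {m : ℕ} (K : Matrix (Fin m) (Fin m) ℂ) (w : Fin m → ℂ)
    (y : Fin m ⊕ Fin m → ℝ) (θ : Fin 2 → ℝ) : ℝ :=
  orthantProb
    (Matrix.diagonal y *ᵥ (invSqrtDiag (realCov K) *ᵥ
      stack (((θ 0 : ℂ) + (θ 1 : ℂ) * Complex.I) • w)))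
    (Matrix.diagonal y * coherence (realCov K) * Matrix.diagonal y)

/-- The log-likelihood of `n` independent stacked one-bit samples `y₁, …, yₙ`. -/
def logLikelihood {m n : ℕ} (K : Matrix (Fin m) (Fin m) ℂ) (W : Matrix (Fin m) (Fin n) ℂ)
    (y : Fin n → Fin m ⊕ Fin m → ℝ) (θ : Fin 2 → ℝ) : ℝ :=
  ∑ i, Real.log (sampleLikelihood K (W.col i) (y i) θ)

/-- The vector of partial derivatives of the log-likelihood with respect to
`θ = (Re β, Im β)`. -/
def score {m n : ℕ} (K : Matrix (Fin m) (Fin m) ℂ) (W : Matrix (Fin m) (Fin n) ℂ)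
    (y : Fin n → Fin m ⊕ Fin m → ℝ) (θ : Fin 2 → ℝ) : Fin 2 → ℝ :=
  fun k => lineDeriv ℝ (logLikelihood K W y) θ (Pi.single k 1)

/-- The Fisher information matrix: the expectation of `score * scoreᵀ` under the one-bit model
with parameter `θ`, a sum over all `2^{2mn}` sign patterns of the data. -/
def fisherInfo {m n : ℕ} (K : Matrix (Fin m) (Fin m) ℂ) (W : Matrix (Fin m) (Fin n) ℂ)
    (θ : Fin 2 → ℝ) : Matrix (Fin 2) (Fin 2) ℝ :=
  ∑ σ : Fin n → Fin m ⊕ Fin m → ℤˣ,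
    let y : Fin n → Fin m ⊕ Fin m → ℝ := fun i j => ((σ i j : ℤ) : ℝ)
    (∏ i, sampleLikelihood K (W.col i) (y i) θ) •
      Matrix.vecMulVec (score K W y θ) (score K W y θ)

/-- Rao's test statistic for `β = 0` against `β ≠ 0`, from the quantized data `Y`. -/
def raoStatistic {m n : ℕ} (K : Matrix (Fin m) (Fin m) ℂ) (W : Matrix (Fin m) (Fin n) ℂ)
    (Y : Matrix (Fin m) (Fin n) ℂ) : ℝ :=
  let g := score K W (fun i => stack (Y.col i)) 0
  g ⬝ᵥ ((fisherInfo K W 0)⁻¹ *ᵥ g)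

/-- The central chi-squared distribution with `f` degrees of freedom: the law of the sum of the
squares of `f` independent standard Gaussian variables. -/
def chiSquared (f : ℕ) : Measure ℝ :=
  (Measure.pi fun _ : Fin f => gaussianReal 0 1).map fun z => ∑ i, z i ^ 2

instance (f : ℕ) : IsProbabilityMeasure (chiSquared f) :=
  Measure.isProbabilityMeasure_map
    (Finset.measurable_sum _ fun i _ => (measurable_pi_apply i).pow_const 2).aemeasurable

end OneBitRadar

end

/-!
Write `G` for the law of the stacked noise `x`, a centred Gaussian measure with covariance matrix
`S = realCov K`, and call the sign vector of `x` its pattern. Rescaling coordinates and applying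
the Cameron–Martin formula, the likelihood of a pattern `y` under the mean `t • u` is
`exp (-t² q / 2)` times the moment generating function at `t` of `x ↦ (S⁻¹ u) ⬝ᵥ x` under `G`
restricted to the orthant of `y`. Its logarithmic derivative at `t = 0` is therefore `u ⬝ᵥ h y`,
where `h y = S⁻¹ E[x | sign x = y]` (`condScore`,
`hasDerivAt_log_setIntegral_gaussianDensity`). Hence the score at `θ = 0` is a sum over the
snapshots of independent vectors, linear in the columns `w_i` of `W` and in `h y_i`
(`score_zero`), each centred because `E[x] = 0` (`sum_patternProb_smul_condScore`). The Fisher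
information is the sum of their second moments (`dotProduct_fisherInfo_mulVec`).

The vectors `h y` span the space: `v ⬝ᵥ h y > 0` when `y` collects the signs of `S⁻¹ v`
(`sum_patternProb_sq_pos`). As `‖stack (β w)‖ = |β| ‖w‖`, the Fisher information `F` thus
dominates a fixed multiple of the total energy `∑ ‖w_i‖²` (`exists_energy_le_fisherInfo`), whereas
the score of snapshot `i` is bounded by a multiple of `‖w_i‖`. Writing `F⁻¹ = Rᵀ R`, the summands of
the normalized score `R g` are uniformly small with total covariance the identity, so a
third-order expansion of the characteristic functions shows that `R g` converges in law to the
standard Gaussian on the plane (`norm_prod_sum_mul_exp_sub_exp_le`,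
`exists_norm_charFun_normalizedScore_sub_le`). Rao's statistic is `‖R g‖²`, and the law of the
squared norm of that Gaussian is `chiSquared 2`, which has the characteristic function of
the exponential distribution with rate `1 / 2` (`chiSquared_two_eq_expMeasure`). This law has no
atoms, so weak convergence gives the limit of the false-alarm probabilities.

A noise entry that is exactly zero is quantized to zero, which is not a sign; this happens with
probability zero, and `ae_exists_mem_orthant` discards it.
-/

noncomputable section

namespace OneBitRadar

/-! ### Gaussian densities -/

section GaussianDensity

variable {ι : Type*} [Fintype ι]

lemma measurable_mulVec (B : Matrix ι ι ℝ) : Measurable fun x : ι → ℝ => B *ᵥ x := by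
  have : Continuous fun x : ι → ℝ => B *ᵥ x := by fun_prop
  exact this.measurable

variable [DecidableEq ι]

lemma pi_gaussianReal_eq_withDensity :
    (Measure.pi fun _ : ι => gaussianReal 0 1) =
      volume.withDensity fun x => ENNReal.ofReal (gaussianDensity 0 (1 : Matrix ι ι ℝ) x) := by
  have hdens : ∀ x : ι → ℝ,
      gaussianDensity 0 (1 : Matrix ι ι ℝ) x = ∏ i, gaussianPDFReal 0 1 (x i) := by
    intro x
    have h1 : (2 * Real.pi) ^ ((Fintype.card ι : ℝ) / 2) = √(2 * Real.pi) ^ Fintype.card ι := by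
      rw [Real.sqrt_eq_rpow, ← Real.rpow_natCast, ← Real.rpow_mul (by positivity)]
      congr 1; ring
    simp only [gaussianDensity, gaussianPDFReal, Finset.prod_mul_distrib, h1,
      ← Real.exp_sum, Finset.prod_const, Finset.card_univ]
    simp [dotProduct, pow_two, Finset.mul_sum, div_eq_inv_mul]
    rw [← inv_pow, mul_inv, mul_comm]
  refine (Measure.pi_eq fun s hs => ?_)
  rw [withDensity_apply _ (MeasurableSet.univ_pi hs)]
  simp_rw [hdens]
  rw [volume_pi, Measure.restrict_pi_pi, ← ofReal_integral_eq_lintegral_ofReal]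
  · rw [integral_fintype_prod_eq_prod (𝕜 := ℝ) (f := fun (_ : ι) x => gaussianPDFReal 0 1 x),
      ENNReal.ofReal_prod_of_nonneg]
    · simp_rw [gaussianReal_apply_eq_integral 0 one_ne_zero]
    · exact fun i _ => integral_nonneg fun x => gaussianPDFReal_nonneg _ _ _
  · exact Integrable.fintype_prod (f := fun (_ : ι) x => gaussianPDFReal 0 1 x)
      fun i => (integrable_gaussianPDFReal 0 1).restrict
  · exact ae_of_all _ fun x => Finset.prod_nonneg fun i _ => gaussianPDFReal_nonneg _ _ _

/-- A linear change of variables turns one Gaussian density into another. -/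
lemma gaussianDensity_mulVec (B S : Matrix ι ι ℝ) (hB : B.det ≠ 0) (u x : ι → ℝ) :
    gaussianDensity (B *ᵥ u) (B * S * Bᵀ) (B *ᵥ x) = |B.det|⁻¹ * gaussianDensity u S x := by
  have hBu : IsUnit B.det := isUnit_iff_ne_zero.mpr hB
  have hquad : (B *ᵥ x - B *ᵥ u) ⬝ᵥ ((B * S * Bᵀ)⁻¹ *ᵥ (B *ᵥ x - B *ᵥ u)) =
      (x - u) ⬝ᵥ (S⁻¹ *ᵥ (x - u)) := by
    rw [← Matrix.mulVec_sub, Matrix.mul_inv_rev, Matrix.mul_inv_rev, Matrix.mulVec_mulVec,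
      Matrix.mul_assoc, Matrix.mul_assoc, Matrix.nonsing_inv_mul _ hBu, Matrix.mul_one,
      Matrix.dotProduct_mulVec, ← Matrix.transpose_nonsing_inv, ← Matrix.vecMul_vecMul,
      Matrix.vecMul_transpose, Matrix.mulVec_mulVec, Matrix.nonsing_inv_mul _ hBu,
      Matrix.one_mulVec, Matrix.dotProduct_mulVec]
  have hdet : √((B * S * Bᵀ).det) = |B.det| * √S.det := by
    rw [Matrix.det_mul, Matrix.det_mul, Matrix.det_transpose,
      show B.det * S.det * B.det = B.det ^ 2 * S.det by ring, Real.sqrt_mul (sq_nonneg _),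
      Real.sqrt_sq_eq_abs]
  unfold gaussianDensity
  rw [hquad, hdet]
  have : |B.det| ≠ 0 := abs_ne_zero.mpr hB
  ring

lemma measurable_gaussianDensity (u : ι → ℝ) (S : Matrix ι ι ℝ) :
    Measurable (gaussianDensity u S) := by
  have : Continuous (gaussianDensity u S) := by
    unfold gaussianDensity
    fun_prop
  exact this.measurable

lemma gaussianDensity_nonneg (u : ι → ℝ) (S : Matrix ι ι ℝ) (x : ι → ℝ) :
    0 ≤ gaussianDensity u S x := by
  unfold gaussianDensity; positivity

lemma gaussianDensity_pos (u : ι → ℝ) {S : Matrix ι ι ℝ} (hS : S.PosDef) (x : ι → ℝ) :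
    0 < gaussianDensity u S x := by
  have := hS.det_pos
  unfold gaussianDensity; positivity

/-- The centred Gaussian measure with covariance matrix `S` on the plain product space `ι → ℝ`. -/
def gaussianPi (S : Matrix ι ι ℝ) : Measure (ι → ℝ) :=
  (multivariateGaussian 0 S).map WithLp.ofLp

instance (S : Matrix ι ι ℝ) : IsProbabilityMeasure (gaussianPi S) :=
  Measure.isProbabilityMeasure_map (by fun_prop)

instance (S : Matrix ι ι ℝ) : IsGaussian (gaussianPi S) := by
  have : gaussianPi S = (multivariateGaussian 0 S).map
      (EuclideanSpace.equiv ι ℝ : EuclideanSpace ℝ ι →L[ℝ] ι → ℝ) := rfl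
  rw [this]
  infer_instance

lemma volume_map_mulVec {B : Matrix ι ι ℝ} (hB : B.det ≠ 0) :
    Measure.map (fun x => B *ᵥ x) volume =
      ENNReal.ofReal |B.det|⁻¹ • (volume : Measure (ι → ℝ)) := by
  have := Real.map_matrix_volume_pi_eq_smul_volume_pi hB
  rw [abs_inv] at this
  exact this

/-- The image of a Gaussian density under an invertible linear map. -/
lemma map_mulVec_withDensity_gaussianDensity {B S : Matrix ι ι ℝ} (hB : B.det ≠ 0) (u : ι → ℝ) :
    (volume.withDensity fun x => ENNReal.ofReal (gaussianDensity u S x)).map (fun x => B *ᵥ x) =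
      volume.withDensity fun x =>
        ENNReal.ofReal (gaussianDensity (B *ᵥ u) (B * S * Bᵀ) x) := by
  have hpos : (0 : ℝ) < |B.det| := abs_pos.mpr hB
  ext s hs
  have hs' := measurable_mulVec B hs
  rw [Measure.map_apply (measurable_mulVec B) hs, withDensity_apply _ hs', withDensity_apply _ hs]
  have hvol : (volume : Measure (ι → ℝ)) =
      ENNReal.ofReal |B.det| • Measure.map (fun x => B *ᵥ x) volume := by
    rw [volume_map_mulVec hB, smul_smul, ← ENNReal.ofReal_mul hpos.le, mul_inv_cancel₀ hpos.ne',
      ENNReal.ofReal_one, one_smul]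
  conv_rhs => rw [hvol]
  rw [Measure.restrict_smul, lintegral_smul_measure, setLIntegral_map hs
    (measurable_gaussianDensity _ _).ennreal_ofReal (measurable_mulVec B)]
  simp_rw [gaussianDensity_mulVec B S hB, ENNReal.ofReal_mul (inv_nonneg.mpr hpos.le)]
  rw [lintegral_const_mul _ (measurable_gaussianDensity _ _).ennreal_ofReal, smul_eq_mul,
    ← mul_assoc, ← ENNReal.ofReal_mul hpos.le, mul_inv_cancel₀ hpos.ne', ENNReal.ofReal_one,
    one_mul]

open scoped MatrixOrder in
/-- A nondegenerate Gaussian measure has the Gaussian density. -/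
lemma gaussianPi_eq_withDensity {S : Matrix ι ι ℝ} (hS : S.PosDef) :
    gaussianPi S = volume.withDensity fun x => ENNReal.ofReal (gaussianDensity 0 S x) := by
  -- `multivariateGaussian 0 S` is by definition the image of the standard Gaussian under `√S`
  set A := CFC.sqrt S with hA
  have hAA : A * A = S := CFC.sqrt_mul_sqrt_self _ hS.posSemidef.nonneg
  have hAT : Aᵀ = A := by
    have := (CFC.sqrt_nonneg S).isSelfAdjoint.star_eq
    rwa [Matrix.star_eq_conjTranspose, Matrix.conjTranspose_eq_transpose_of_trivial] at this
  have hdet : A.det ≠ 0 := by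
    intro h
    have := hS.det_pos
    rw [← hAA, Matrix.det_mul, h] at this
    simp at this
  have h1 : gaussianPi S = (Measure.pi fun _ : ι => gaussianReal 0 1).map (fun x => A *ᵥ x) := by
    rw [gaussianPi, multivariateGaussian, ← map_pi_eq_stdGaussian,
      Measure.map_map (by fun_prop) (by fun_prop), Measure.map_map (by fun_prop) (by fun_prop)]
    congr 1
    ext x i
    simp [hA]
  rw [h1, pi_gaussianReal_eq_withDensity, map_mulVec_withDensity_gaussianDensity hdet,
    Matrix.mul_one, hAT, hAA, Matrix.mulVec_zero]

end GaussianDensity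

/-! ### Orthant probabilities and the derivative of their logarithm -/

section Orthant

variable {ι : Type*}

/-- The open orthant of the vectors whose coordinates have the signs of the coordinates of `y`. -/
def orthant (y : ι → ℝ) : Set (ι → ℝ) := {x | ∀ j, 0 < y j * x j}

lemma isOpen_orthant [Finite ι] (y : ι → ℝ) : IsOpen (orthant y) := by
  have : orthant y = ⋂ j, {x | 0 < y j * x j} := by ext; simp [orthant]
  rw [this]
  exact isOpen_iInter_of_finite fun j => isOpen_lt continuous_const (by fun_prop)

lemma measurableSet_orthant [Finite ι] (y : ι → ℝ) : MeasurableSet (orthant y) :=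
  (isOpen_orthant y).measurableSet

/-- A sign pattern, as a real vector. -/
def signVec (σ : ι → ℤˣ) : ι → ℝ := fun j => ((σ j : ℤ) : ℝ)

lemma signVec_mul_self (σ : ι → ℤˣ) (j : ι) : signVec σ j * signVec σ j = 1 := by
  rcases Int.units_eq_one_or (σ j) with h | h <;> simp [signVec, h]

lemma signVec_ne_zero (σ : ι → ℤˣ) (j : ι) : signVec σ j ≠ 0 := by
  intro h
  have := signVec_mul_self σ j
  simp [h] at this

variable [Fintype ι] [DecidableEq ι]

lemma _root_.Matrix.PosDef.transpose_inv {S : Matrix ι ι ℝ} (hS : S.PosDef) : (S⁻¹)ᵀ = S⁻¹ := by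
  have := hS.inv.isHermitian.eq
  rwa [Matrix.conjTranspose_eq_transpose_of_trivial] at this

/-- The probability that a centred Gaussian vector has the sign pattern `y`. -/
def patternProb (S : Matrix ι ι ℝ) (y : ι → ℝ) : ℝ := (gaussianPi S).real (orthant y)

/-- The whitened conditional mean `S⁻¹ E[x | sign x = y]` of a centred Gaussian vector `x` with
covariance matrix `S`, given its sign pattern `y`. -/
def condScore (S : Matrix ι ι ℝ) (y : ι → ℝ) : ι → ℝ :=
  (patternProb S y)⁻¹ • (S⁻¹ *ᵥ fun j => ∫ x in orthant y, x j ∂gaussianPi S)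

lemma patternProb_pos {S : Matrix ι ι ℝ} (hS : S.PosDef) (σ : ι → ℤˣ) :
    0 < patternProb S (signVec σ) := by
  have hne : (orthant (signVec σ)).Nonempty :=
    ⟨signVec σ, fun j => by rw [signVec_mul_self]; exact one_pos⟩
  have hac : (volume : Measure (ι → ℝ)) ≪ gaussianPi S := by
    rw [gaussianPi_eq_withDensity hS]
    refine withDensity_absolutelyContinuous'
      (measurable_gaussianDensity _ _).ennreal_ofReal.aemeasurable (ae_of_all _ fun x => ?_)
    simpa using gaussianDensity_pos 0 hS x
  refine ENNReal.toReal_pos (fun h => ?_) (measure_ne_top _ _)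
  exact (isOpen_orthant _).measure_ne_zero volume hne (hac h)

lemma integral_gaussianPi {S : Matrix ι ι ℝ} (hS : S.PosDef) {s : Set (ι → ℝ)}
    (hs : MeasurableSet s) (f : (ι → ℝ) → ℝ) :
    ∫ x in s, f x ∂gaussianPi S = ∫ x in s, gaussianDensity 0 S x * f x := by
  rw [gaussianPi_eq_withDensity hS, setIntegral_withDensity_eq_setIntegral_toReal_smul
    (measurable_gaussianDensity _ _).ennreal_ofReal (by simp) _ hs]
  simp [ENNReal.toReal_ofReal (gaussianDensity_nonneg _ _ _)]

/-- Rescaling the coordinates turns the orthant probability of the standardized vector into an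
integral over the orthant with sign pattern `y`. -/
lemma orthantProb_diagonal (S : Matrix ι ι ℝ) (y u d : ι → ℝ) (hy : ∀ j, y j ≠ 0)
    (hd : ∀ j, 0 < d j) :
    orthantProb (Matrix.diagonal y *ᵥ (Matrix.diagonal d *ᵥ u))
        (Matrix.diagonal y * (Matrix.diagonal d * S * Matrix.diagonal d) * Matrix.diagonal y) =
      ∫ x in orthant y, gaussianDensity u S x := by
  set B : Matrix ι ι ℝ := Matrix.diagonal y * Matrix.diagonal d with hBdef
  have hB : B.det ≠ 0 := by
    simp only [hBdef, Matrix.det_mul, Matrix.det_diagonal]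
    exact mul_ne_zero (Finset.prod_ne_zero_iff.mpr fun j _ => hy j)
      (Finset.prod_ne_zero_iff.mpr fun j _ => (hd j).ne')
  have hcov : Matrix.diagonal y * (Matrix.diagonal d * S * Matrix.diagonal d) * Matrix.diagonal y =
      B * S * Bᵀ := by
    rw [hBdef, Matrix.transpose_mul, Matrix.diagonal_transpose, Matrix.diagonal_transpose]
    simp only [Matrix.mul_assoc]
  have hpre : (fun x => B *ᵥ x) ⁻¹' (Set.univ.pi fun _ => Set.Ioi (0 : ℝ)) = orthant y := by
    ext x
    simp only [Set.mem_preimage, Set.mem_univ_pi, Set.mem_Ioi, orthant, Set.mem_ofPred_eq]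
    refine forall_congr' fun j => ?_
    rw [hBdef, Matrix.diagonal_mul_diagonal, Matrix.mulVec_diagonal,
      mul_right_comm, mul_pos_iff_of_pos_right (hd j)]
  have hpos : MeasurableSet (Set.univ.pi fun _ : ι => Set.Ioi (0 : ℝ)) :=
    MeasurableSet.univ_pi fun _ => measurableSet_Ioi
  have key := map_mulVec_withDensity_gaussianDensity (S := S) hB u
  unfold orthantProb
  rw [Matrix.mulVec_mulVec, ← hBdef, hcov]
  have e1 : ∀ (v : ι → ℝ) (C : Matrix ι ι ℝ) (s : Set (ι → ℝ)), MeasurableSet s →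
      ∫ x in s, gaussianDensity v C x =
        ((volume.withDensity fun x => ENNReal.ofReal (gaussianDensity v C x)) s).toReal := by
    intro v C s hs
    rw [withDensity_apply _ hs, integral_eq_lintegral_of_nonneg_ae
      (ae_of_all _ fun x => gaussianDensity_nonneg _ _ _)
      (measurable_gaussianDensity _ _).aestronglyMeasurable]
  rw [e1 _ _ _ hpos, e1 _ _ _ (measurableSet_orthant y), ← key,
    Measure.map_apply (measurable_mulVec B) hpos, hpre]

/-- Shifting the mean of a Gaussian density multiplies it by an exponential (Cameron–Martin). -/
lemma gaussianDensity_eq_exp_mul {S : Matrix ι ι ℝ} (hS : S.PosDef) (u x : ι → ℝ) :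
    gaussianDensity u S x = Real.exp (-(1 / 2) * (u ⬝ᵥ (S⁻¹ *ᵥ u))) *
      (gaussianDensity 0 S x * Real.exp ((S⁻¹ *ᵥ u) ⬝ᵥ x)) := by
  have hsymm := hS.transpose_inv
  have h1 : u ⬝ᵥ (S⁻¹ *ᵥ x) = (S⁻¹ *ᵥ u) ⬝ᵥ x := by
    rw [Matrix.dotProduct_mulVec, ← Matrix.mulVec_transpose, hsymm]
  have h2 : x ⬝ᵥ (S⁻¹ *ᵥ u) = (S⁻¹ *ᵥ u) ⬝ᵥ x := dotProduct_comm _ _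
  unfold gaussianDensity
  rw [sub_zero, mul_left_comm, mul_assoc, mul_left_comm (Real.exp _), ← Real.exp_add,
    ← Real.exp_add]
  congr 2
  simp only [Matrix.mulVec_sub, sub_dotProduct, dotProduct_sub, h1, h2]
  ring

/-- Linear functionals of a Gaussian vector have all exponential moments, on any set. -/
lemma integrableExpSet_dotProduct_gaussianPi (S : Matrix ι ι ℝ) (v : ι → ℝ) (s : Set (ι → ℝ)) :
    integrableExpSet (fun x => v ⬝ᵥ x) ((gaussianPi S).restrict s) = Set.univ := by
  refine Set.eq_univ_of_forall fun t => ?_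
  let L : StrongDual ℝ (ι → ℝ) := LinearMap.toContinuousLinearMap (dotProductBilin ℝ ℝ v)
  have hL : ∀ x, L x = v ⬝ᵥ x := fun x => rfl
  have hmap := IsGaussian.map_eq_gaussianReal (μ := gaussianPi S) L
  have hint := integrable_exp_mul_gaussianReal (μ := (gaussianPi S)[L])
    (v := (Var[L; gaussianPi S]).toNNReal) t
  rw [← hmap, integrable_map_measure (by fun_prop) (by fun_prop)] at hint
  exact hint.restrict

lemma integrable_eval_gaussianPi (S : Matrix ι ι ℝ) (j : ι) :
    Integrable (fun x : ι → ℝ => x j) (gaussianPi S) :=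
  IsGaussian.integrable_id.eval j

lemma setIntegral_dotProduct_gaussianPi (S : Matrix ι ι ℝ) (v : ι → ℝ) (s : Set (ι → ℝ)) :
    ∫ x in s, v ⬝ᵥ x ∂gaussianPi S = v ⬝ᵥ fun j => ∫ x in s, x j ∂gaussianPi S := by
  simp only [dotProduct]
  rw [integral_finsetSum _ fun j _ => ((integrable_eval_gaussianPi S j).restrict).const_mul _]
  simp_rw [integral_const_mul]

/-- The directional derivative of the log-likelihood of a sign pattern at the zero mean is the
inner product of the direction with `condScore`. -/
lemma hasDerivAt_log_setIntegral_gaussianDensity {S : Matrix ι ι ℝ} (hS : S.PosDef) (u : ι → ℝ)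
    (σ : ι → ℤˣ) :
    HasDerivAt (fun t : ℝ => Real.log
        (∫ x in orthant (signVec σ), gaussianDensity (t • u) S x))
      (u ⬝ᵥ condScore S (signVec σ)) 0 := by
  -- as a function of `t`, the integral is a Gaussian factor times a moment generating function
  set O := orthant (signVec σ)
  set ν := (gaussianPi S).restrict O
  set q := u ⬝ᵥ (S⁻¹ *ᵥ u)
  set X : (ι → ℝ) → ℝ := fun x => (S⁻¹ *ᵥ u) ⬝ᵥ x with hX
  have hsymm := hS.transpose_inv
  have heq : (fun t : ℝ => ∫ x in O, gaussianDensity (t • u) S x) =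
      fun t => Real.exp (-(1 / 2) * (t ^ 2 * q)) * mgf X ν t := by
    funext t
    simp_rw [gaussianDensity_eq_exp_mul hS (t • u), mgf]
    rw [integral_const_mul, integral_gaussianPi hS (measurableSet_orthant _)]
    simp only [Matrix.mulVec_smul, dotProduct_smul, smul_dotProduct, smul_eq_mul, hX, q, O]
    ring_nf
  have hm : HasDerivAt (mgf X ν) (∫ x, X x ∂ν) 0 := by
    have := hasDerivAt_mgf (X := X) (μ := ν) (t := 0)
      (by rw [integrableExpSet_dotProduct_gaussianPi]; simp)
    simpa using this
  have he : HasDerivAt (fun t : ℝ => Real.exp (-(1 / 2) * (t ^ 2 * q))) 0 0 := by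
    have := ((((hasDerivAt_id (0 : ℝ)).pow 2).mul_const q).const_mul (-(1 / 2))).exp
    simpa using this
  have hp : mgf X ν 0 = patternProb S (signVec σ) := by
    rw [mgf_zero']
    simp [patternProb, ν, O]
  have hp0 := patternProb_pos hS σ
  have hd := (he.mul hm).log (by simp [hp, hp0.ne'])
  rw [show (fun t : ℝ => Real.log (∫ x in O, gaussianDensity (t • u) S x)) =
    fun t => Real.log ((fun t => Real.exp (-(1 / 2) * (t ^ 2 * q))) t * mgf X ν t) from
      funext fun t => congrArg Real.log (congrFun heq t)]
  refine hd.congr_deriv ?_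
  rw [Pi.mul_apply, hp]
  rw [show (∫ x, X x ∂ν) = (S⁻¹ *ᵥ u) ⬝ᵥ fun j => ∫ x in O, x j ∂gaussianPi S from
    setIntegral_dotProduct_gaussianPi S _ _]
  rw [condScore, dotProduct_smul, Matrix.dotProduct_mulVec, ← Matrix.mulVec_transpose, hsymm]
  simp [div_eq_inv_mul, O]

end Orthant

/-! ### Sign patterns of a Gaussian vector -/

section Patterns

variable {ι : Type*}

lemma eq_of_mem_orthant_signVec {σ τ : ι → ℤˣ} {x : ι → ℝ} (hσ : x ∈ orthant (signVec σ))
    (hτ : x ∈ orthant (signVec τ)) : σ = τ := by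
  funext j
  have h1 := hσ j
  have h2 := hτ j
  rcases Int.units_eq_one_or (σ j) with h | h <;> rcases Int.units_eq_one_or (τ j) with h' | h' <;>
    simp [signVec, h, h'] at h1 h2 ⊢ <;> linarith

lemma disjoint_orthant_signVec :
    Pairwise (Function.onFun Disjoint fun σ : ι → ℤˣ => orthant (signVec σ)) :=
  fun _ _ hne => Set.disjoint_left.mpr fun _ h1 h2 => hne (eq_of_mem_orthant_signVec h1 h2)

variable [Fintype ι] [DecidableEq ι]

lemma ae_exists_mem_orthant {S : Matrix ι ι ℝ} (hS : S.PosDef) :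
    ∀ᵐ x ∂gaussianPi S, ∃ σ : ι → ℤˣ, x ∈ orthant (signVec σ) := by
  have hac : gaussianPi S ≪ volume := by
    rw [gaussianPi_eq_withDensity hS]
    exact withDensity_absolutelyContinuous _ _
  have h0 : ∀ᵐ x : ι → ℝ ∂volume, ∀ j, x j ≠ 0 :=
    ae_all_iff.mpr fun j => Measure.pi_hyperplane (fun _ => volume) j 0 |> fun h => by
      rw [ae_iff]
      simpa [volume_pi] using h
  filter_upwards [hac.ae_le h0] with x hx
  refine ⟨fun j => if 0 < x j then 1 else -1, fun j => ?_⟩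
  by_cases h : 0 < x j
  · simp [signVec, h]
  · have : x j < 0 := lt_of_le_of_ne (not_lt.mp h) (hx j)
    simp [signVec, h, this]

lemma integral_eq_sum_orthant {S : Matrix ι ι ℝ} (hS : S.PosDef) {E : Type*}
    [NormedAddCommGroup E] [NormedSpace ℝ E] {f : (ι → ℝ) → E} (hf : Integrable f (gaussianPi S)) :
    ∫ x, f x ∂gaussianPi S = ∑ σ : ι → ℤˣ, ∫ x in orthant (signVec σ), f x ∂gaussianPi S := by
  rw [← integral_iUnion_fintype (fun σ => measurableSet_orthant _) disjoint_orthant_signVec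
    fun σ => hf.integrableOn, setIntegral_eq_integral_of_ae_compl_eq_zero]
  filter_upwards [ae_exists_mem_orthant hS] with x hx h
  exact absurd (Set.mem_iUnion.mpr hx) h

/-- The value of `f` at the sign pattern of `x`, as a function on the whole space; it is `0` at the
vectors with a zero coordinate, which lie in no open orthant. -/
def patternFun {E : Type*} [AddCommMonoid E] (f : (ι → ℤˣ) → E) (x : ι → ℝ) : E :=
  ∑ σ, (orthant (signVec σ)).indicator (fun _ => f σ) x

lemma patternFun_of_mem {E : Type*} [AddCommMonoid E] (f : (ι → ℤˣ) → E) {x : ι → ℝ}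
    {σ : ι → ℤˣ} (hx : x ∈ orthant (signVec σ)) : patternFun f x = f σ := by
  rw [patternFun, Finset.sum_eq_single σ]
  · simp [hx]
  · intro τ _ hne
    exact Set.indicator_of_notMem (fun h => hne (eq_of_mem_orthant_signVec h hx)) _
  · simp

lemma integral_pattern {S : Matrix ι ι ℝ} (hS : S.PosDef) {E : Type*} [NormedAddCommGroup E]
    [NormedSpace ℝ E] [CompleteSpace E] {f : (ι → ℝ) → E} (g : (ι → ℤˣ) → E) (hf : Integrable f (gaussianPi S))
    (hg : ∀ σ, ∀ x ∈ orthant (signVec σ), f x = g σ) :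
    ∫ x, f x ∂gaussianPi S = ∑ σ, patternProb S (signVec σ) • g σ := by
  rw [integral_eq_sum_orthant hS hf]
  refine Finset.sum_congr rfl fun σ _ => ?_
  rw [setIntegral_congr_fun (measurableSet_orthant _) (hg σ), setIntegral_const]
  rfl

lemma sum_patternProb {S : Matrix ι ι ℝ} (hS : S.PosDef) :
    ∑ σ : ι → ℤˣ, patternProb S (signVec σ) = 1 := by
  have := integral_pattern hS (f := fun _ => (1 : ℝ)) (fun _ => 1) (integrable_const _) (by simp)
  simpa using this.symm

/-- The score has mean zero, because the Gaussian vector does. -/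
lemma sum_patternProb_smul_condScore {S : Matrix ι ι ℝ} (hS : S.PosDef) :
    ∑ σ : ι → ℤˣ, patternProb S (signVec σ) • condScore S (signVec σ) = 0 := by
  have h1 : ∀ σ : ι → ℤˣ, patternProb S (signVec σ) • condScore S (signVec σ) =
      S⁻¹ *ᵥ fun j => ∫ x in orthant (signVec σ), x j ∂gaussianPi S := fun σ => by
    rw [condScore, smul_smul, mul_inv_cancel₀ (patternProb_pos hS σ).ne', one_smul]
  have h2 : (∑ σ : ι → ℤˣ, fun j => ∫ x in orthant (signVec σ), x j ∂gaussianPi S) = 0 := by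
    funext j
    rw [Finset.sum_apply, ← integral_eq_sum_orthant hS (integrable_eval_gaussianPi S j),
      gaussianPi]
    have h4 : ∫ x : ι → ℝ, x j ∂(multivariateGaussian 0 S).map WithLp.ofLp =
        ∫ x : EuclideanSpace ℝ ι, x.ofLp j ∂multivariateGaussian 0 S :=
      integral_map (by fun_prop) (measurable_pi_apply j).aestronglyMeasurable
    have := integral_id_multivariateGaussian (μ := (0 : EuclideanSpace ℝ ι)) (S := S)
    have h3 := (EuclideanSpace.proj j : EuclideanSpace ℝ ι →L[ℝ] ℝ).integral_comp_comm
      (μ := multivariateGaussian 0 S) (φ := fun x => x) IsGaussian.integrable_id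
    rw [this] at h3
    rw [h4]
    simpa using h3
  simp_rw [h1]
  rw [← Matrix.mulVec_sum, h2, Matrix.mulVec_zero]

/-- The conditional means of a Gaussian vector over the orthants span the space: testing `v`
against the orthant that contains the signs of `S⁻¹ v` gives a positive value. -/
lemma sum_patternProb_sq_pos {S : Matrix ι ι ℝ} (hS : S.PosDef) {v : ι → ℝ} (hv : v ≠ 0) :
    0 < ∑ σ : ι → ℤˣ, patternProb S (signVec σ) * (v ⬝ᵥ condScore S (signVec σ)) ^ 2 := by
  set w := S⁻¹ *ᵥ v with hw
  have hw0 : w ≠ 0 := by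
    intro h
    have := hS.inv.dotProduct_mulVec_pos hv
    rw [← hw, h] at this
    simp at this
  let τ : ι → ℤˣ := fun j => if 0 ≤ w j then 1 else -1
  have hnn : ∀ x ∈ orthant (signVec τ), ∀ j, 0 ≤ w j * x j := by
    intro x hx j
    have := hx j
    by_cases h : 0 ≤ w j
    · simp only [signVec, τ, h, if_true, Units.val_one, Int.cast_one, one_mul] at this
      positivity
    · simp only [signVec, τ, h, if_false, Units.val_neg, Units.val_one, Int.cast_neg,
        Int.cast_one] at this
      exact mul_nonneg_of_nonpos_of_nonpos (not_le.mp h).le (by linarith)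
  have hpos : ∀ x ∈ orthant (signVec τ), 0 < w ⬝ᵥ x := by
    intro x hx
    obtain ⟨j, hj⟩ := Function.ne_iff.mp hw0
    have hxj : x j ≠ 0 := fun h => by simpa [h] using hx j
    exact Finset.sum_pos' (fun i _ => hnn x hx i)
      ⟨j, Finset.mem_univ _, lt_of_le_of_ne (hnn x hx j) (mul_ne_zero hj hxj).symm⟩
  have hint : Integrable (fun x => w ⬝ᵥ x) ((gaussianPi S).restrict (orthant (signVec τ))) := by
    simp only [dotProduct]
    exact integrable_finsetSum _ fun j _ =>
      ((integrable_eval_gaussianPi S j).restrict).const_mul _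
  have hI : 0 < ∫ x in orthant (signVec τ), w ⬝ᵥ x ∂gaussianPi S := by
    rw [setIntegral_pos_iff_support_of_nonneg_ae
      (ae_restrict_of_forall_mem (measurableSet_orthant _) fun x hx => (hpos x hx).le) hint]
    have : Function.support (fun x => w ⬝ᵥ x) ∩ orthant (signVec τ) = orthant (signVec τ) :=
      Set.inter_eq_right.mpr fun x hx => (hpos x hx).ne'
    rw [this, pos_iff_ne_zero]
    intro h
    have := patternProb_pos hS τ
    simp [patternProb, Measure.real, h] at this
  refine Finset.sum_pos' (fun σ _ => mul_nonneg (patternProb_pos hS σ).le (sq_nonneg _))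
    ⟨τ, Finset.mem_univ _, mul_pos (patternProb_pos hS τ) (pow_pos ?_ 2)⟩
  rw [condScore, dotProduct_smul, Matrix.dotProduct_mulVec, ← Matrix.mulVec_transpose,
    hS.transpose_inv, ← hw, ← setIntegral_dotProduct_gaussianPi]
  exact mul_pos (inv_pos.mpr (patternProb_pos hS τ)) hI

/-- The second-moment form of `condScore` is coercive: it is positive on the compact unit sphere and
homogeneous of degree two. -/
lemma exists_le_sum_patternProb_sq {S : Matrix ι ι ℝ} (hS : S.PosDef) :
    ∃ c : ℝ, 0 < c ∧ ∀ v : ι → ℝ, c * (v ⬝ᵥ v) ≤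
      ∑ σ : ι → ℤˣ, patternProb S (signVec σ) * (v ⬝ᵥ condScore S (signVec σ)) ^ 2 := by
  set Q : (ι → ℝ) → ℝ := fun v =>
    ∑ σ : ι → ℤˣ, patternProb S (signVec σ) * (v ⬝ᵥ condScore S (signVec σ)) ^ 2 with hQ
  rcases isEmpty_or_nonempty ι with hι | hι
  · exact ⟨1, one_pos, fun v => by
      simp⟩
  have hcont : Continuous Q := by
    simp only [hQ, dotProduct]
    fun_prop
  obtain ⟨v₀, hv₀, hmin⟩ := (isCompact_sphere (0 : ι → ℝ) 1).exists_isMinOn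
    (NormedSpace.sphere_nonempty.mpr zero_le_one) hcont.continuousOn
  have hv₀' : v₀ ≠ 0 := by
    rintro rfl
    simp at hv₀
  have hq := sum_patternProb_sq_pos hS hv₀'
  have hcard : (0 : ℝ) < Fintype.card ι := by exact_mod_cast Fintype.card_pos
  refine ⟨Q v₀ / Fintype.card ι, div_pos hq hcard, fun v => ?_⟩
  change _ ≤ Q v
  have hdot : v ⬝ᵥ v ≤ Fintype.card ι * ‖v‖ ^ 2 := by
    calc v ⬝ᵥ v ≤ ∑ _j : ι, ‖v‖ ^ 2 := Finset.sum_le_sum fun j _ => by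
          have := norm_le_pi_norm v j
          rw [Real.norm_eq_abs] at this
          nlinarith [abs_mul_abs_self (v j), abs_nonneg (v j)]
      _ = _ := by simp
  have hscale : Q v₀ * ‖v‖ ^ 2 ≤ Q v := by
    by_cases hv : v = 0
    · subst hv
      simp [hQ]
    have hn : ‖v‖ ≠ 0 := norm_ne_zero_iff.mpr hv
    have h1 : Q v₀ ≤ Q (‖v‖⁻¹ • v) := hmin (by simp [norm_smul, hn])
    have h2 : Q (‖v‖⁻¹ • v) = ‖v‖⁻¹ ^ 2 * Q v := by
      simp only [hQ, smul_dotProduct, smul_eq_mul, Finset.mul_sum]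
      exact Finset.sum_congr rfl fun σ _ => by ring
    rw [h2] at h1
    calc Q v₀ * ‖v‖ ^ 2 ≤ ‖v‖⁻¹ ^ 2 * Q v * ‖v‖ ^ 2 := by gcongr
      _ = Q v := by field_simp
  calc Q v₀ / Fintype.card ι * (v ⬝ᵥ v)
      ≤ Q v₀ / Fintype.card ι * (Fintype.card ι * ‖v‖ ^ 2) := by gcongr
    _ = Q v₀ * ‖v‖ ^ 2 := by field_simp
    _ ≤ Q v := hscale

lemma exists_sq_dotProduct_condScore_le (S : Matrix ι ι ℝ) :
    ∃ C : ℝ, 0 < C ∧ ∀ (σ : ι → ℤˣ) (v : ι → ℝ),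
      (v ⬝ᵥ condScore S (signVec σ)) ^ 2 ≤ C * (v ⬝ᵥ v) := by
  have hnn : ∀ u : ι → ℝ, 0 ≤ u ⬝ᵥ u := fun u => Finset.sum_nonneg fun j _ => mul_self_nonneg _
  refine ⟨1 + ∑ σ : ι → ℤˣ, condScore S (signVec σ) ⬝ᵥ condScore S (signVec σ),
    by linarith [Finset.sum_nonneg fun (σ : ι → ℤˣ) (_ : σ ∈ Finset.univ) =>
      hnn (condScore S (signVec σ))], fun σ v => ?_⟩
  have h1 : (v ⬝ᵥ condScore S (signVec σ)) ^ 2 ≤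
      (v ⬝ᵥ v) * (condScore S (signVec σ) ⬝ᵥ condScore S (signVec σ)) := by
    simpa only [dotProduct, ← pow_two] using
      Finset.sum_mul_sq_le_sq_mul_sq Finset.univ v (condScore S (signVec σ))
  have h2 := Finset.single_le_sum (f := fun σ : ι → ℤˣ =>
    condScore S (signVec σ) ⬝ᵥ condScore S (signVec σ)) (fun σ _ => hnn _) (Finset.mem_univ σ)
  nlinarith [hnn v]

end Patterns

/-! ### Score and Fisher information at zero reflectivity -/

/-- The quadratic form of `realCov K` at the stacked vector of `z` is half the Hermitian form of `K`
at `z`. -/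
lemma dotProduct_mulVec_realCov {m : ℕ} (K : Matrix (Fin m) (Fin m) ℂ)
    (x : Fin m ⊕ Fin m → ℝ) :
    x ⬝ᵥ (realCov K *ᵥ x) =
      1 / 2 * (star (fun j => (⟨x (.inl j), x (.inr j)⟩ : ℂ)) ⬝ᵥ
        (K *ᵥ fun j => (⟨x (.inl j), x (.inr j)⟩ : ℂ))).re := by
  simp only [realCov, Matrix.smul_mulVec, dotProduct_smul, smul_eq_mul]
  congr 1
  simp only [dotProduct, Matrix.mulVec, Fintype.sum_sum_type, Complex.re_sum, Pi.star_apply,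
    Complex.mul_re, ← Finset.sum_add_distrib, Matrix.fromBlocks_apply₁₁,
    Matrix.fromBlocks_apply₁₂, Matrix.fromBlocks_apply₂₁, Matrix.fromBlocks_apply₂₂,
    Matrix.map_apply, Matrix.neg_apply, Complex.mul_im, Finset.mul_sum, Complex.star_def,
    Complex.conj_re, Complex.conj_im]
  refine Finset.sum_congr rfl fun i _ => Finset.sum_congr rfl fun j _ => by ring

lemma posDef_realCov {m : ℕ} {K : Matrix (Fin m) (Fin m) ℂ} (hK : K.PosDef) :
    (realCov K).PosDef := by
  have hre : ∀ i j, (K i j).re = (K j i).re := fun i j => by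
    conv_lhs => rw [← hK.isHermitian.apply i j]
    simp
  have him : ∀ i j, (K i j).im = -(K j i).im := fun i j => by
    conv_lhs => rw [← hK.isHermitian.apply i j]
    simp
  refine Matrix.PosDef.of_dotProduct_mulVec_pos ?_ fun {x} hx => ?_
  · ext i j
    rcases i with i | i <;> rcases j with j | j <;> simp [realCov]
    · exact hre j i
    · rw [him j i]; ring
    · rw [him j i]; ring
    · exact hre j i
  · rw [star_trivial, dotProduct_mulVec_realCov]
    have hz : (fun j => (⟨x (.inl j), x (.inr j)⟩ : ℂ)) ≠ 0 := by
      intro h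
      refine hx (funext fun j => ?_)
      rcases j with j | j
      · exact congrArg Complex.re (congrFun h j)
      · exact congrArg Complex.im (congrFun h j)
    have := (Complex.pos_iff.mp (hK.dotProduct_mulVec_pos hz)).1
    linarith

lemma stack_add {m : ℕ} (x y : Fin m → ℂ) : stack (x + y) = stack x + stack y := by
  ext j; rcases j with j | j <;> simp [stack]

lemma stack_ofReal_smul {m : ℕ} (a : ℝ) (x : Fin m → ℂ) :
    stack ((a : ℂ) • x) = a • stack x := by
  ext j; rcases j with j | j <;> simp [stack]

/-- The derivatives of the stacked mean `stack ((θ₀ + ı θ₁) w)` with respect to `θ₀` and `θ₁`. -/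
def meanDeriv {m : ℕ} (w : Fin m → ℂ) : Fin 2 → Fin m ⊕ Fin m → ℝ :=
  ![stack w, stack (Complex.I • w)]

lemma stack_smul {m : ℕ} (w : Fin m → ℂ) (θ : Fin 2 → ℝ) :
    stack (((θ 0 : ℂ) + (θ 1 : ℂ) * Complex.I) • w) = ∑ k, θ k • meanDeriv w k := by
  rw [add_smul, mul_smul, stack_add, stack_ofReal_smul, stack_ofReal_smul]
  simp [meanDeriv]

/-- Stacking is an isometry, so the stacked mean has squared norm `|θ₀ + ı θ₁|² ‖w‖²`. -/
lemma dotProduct_stack_smul {m : ℕ} (w : Fin m → ℂ) (θ : Fin 2 → ℝ) :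
    (∑ k, θ k • meanDeriv w k) ⬝ᵥ (∑ k, θ k • meanDeriv w k) =
      (θ ⬝ᵥ θ) * ∑ j, ‖w j‖ ^ 2 := by
  rw [← stack_smul]
  simp only [dotProduct, Fintype.sum_sum_type, stack, Sum.elim_inl, Sum.elim_inr, Pi.smul_apply,
    smul_eq_mul, Fin.sum_univ_two, Complex.sq_norm, Complex.normSq_apply, Finset.mul_sum,
    ← Finset.sum_add_distrib]
  refine Finset.sum_congr rfl fun j _ => ?_
  simp
  ring

lemma sampleLikelihood_eq {m : ℕ} {K : Matrix (Fin m) (Fin m) ℂ} (hK : K.PosDef)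
    (w : Fin m → ℂ) (σ : Fin m ⊕ Fin m → ℤˣ) (θ : Fin 2 → ℝ) :
    sampleLikelihood K w (signVec σ) θ =
      ∫ x in orthant (signVec σ), gaussianDensity (∑ k, θ k • meanDeriv w k) (realCov K) x := by
  rw [sampleLikelihood, stack_smul]
  exact orthantProb_diagonal _ _ _ _ (signVec_ne_zero σ) fun j =>
    one_div_pos.mpr (Real.sqrt_pos.mpr (posDef_realCov hK).diag_pos)

lemma sampleLikelihood_zero {m : ℕ} {K : Matrix (Fin m) (Fin m) ℂ} (hK : K.PosDef)
    (w : Fin m → ℂ) (σ : Fin m ⊕ Fin m → ℤˣ) :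
    sampleLikelihood K w (signVec σ) 0 = patternProb (realCov K) (signVec σ) := by
  have := integral_gaussianPi (posDef_realCov hK) (measurableSet_orthant (signVec σ)) fun _ => 1
  rw [sampleLikelihood_eq hK]
  simp only [Pi.zero_apply, zero_smul, Finset.sum_const_zero]
  simpa [patternProb] using this.symm

/-- The score at `θ = 0` of a single sample with sign pattern `y`: the derivative of its
log-likelihood, in the closed form given by `condScore`. -/
def sampleScore {m : ℕ} (K : Matrix (Fin m) (Fin m) ℂ) (w : Fin m → ℂ)
    (y : Fin m ⊕ Fin m → ℝ) : Fin 2 → ℝ :=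
  fun k => meanDeriv w k ⬝ᵥ condScore (realCov K) y

lemma score_zero {m n : ℕ} {K : Matrix (Fin m) (Fin m) ℂ} (hK : K.PosDef)
    (W : Matrix (Fin m) (Fin n) ℂ) (σ : Fin n → Fin m ⊕ Fin m → ℤˣ) :
    score K W (fun i => signVec (σ i)) 0 = ∑ i, sampleScore K (W.col i) (signVec (σ i)) := by
  funext k
  rw [score, lineDeriv, Finset.sum_apply]
  refine HasDerivAt.deriv ?_
  simp only [logLikelihood]
  refine HasDerivAt.fun_sum fun i _ => ?_
  have hmean : ∀ t : ℝ,
      ∑ l, (0 + t • Pi.single k 1 : Fin 2 → ℝ) l • meanDeriv (W.col i) l =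
        t • meanDeriv (W.col i) k := fun t => by
    fin_cases k <;> simp
  simp_rw [sampleLikelihood_eq hK, hmean]
  exact hasDerivAt_log_setIntegral_gaussianDensity (posDef_realCov hK) _ (σ i)

lemma dotProduct_sampleScore {m : ℕ} (K : Matrix (Fin m) (Fin m) ℂ) (w : Fin m → ℂ)
    (y : Fin m ⊕ Fin m → ℝ) (v : Fin 2 → ℝ) :
    v ⬝ᵥ sampleScore K w y = (∑ k, v k • meanDeriv w k) ⬝ᵥ condScore (realCov K) y := by
  rw [sum_dotProduct]
  simp only [smul_dotProduct, smul_eq_mul]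
  rfl

lemma sum_patternProb_mul_dotProduct_sampleScore {m : ℕ} {K : Matrix (Fin m) (Fin m) ℂ}
    (hK : K.PosDef) (w : Fin m → ℂ) (v : Fin 2 → ℝ) :
    ∑ σ : Fin m ⊕ Fin m → ℤˣ, patternProb (realCov K) (signVec σ) *
      (v ⬝ᵥ sampleScore K w (signVec σ)) = 0 := by
  simp_rw [dotProduct_sampleScore, ← smul_eq_mul, ← dotProduct_smul]
  rw [← dotProduct_sum, sum_patternProb_smul_condScore (posDef_realCov hK), dotProduct_zero]

/-- Total mass, mean and second moment of a sum of independent centred variables, each a function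
of a draw from the finite distribution `p`. -/
lemma sum_prod_mul_sum {α : Type*} [Fintype α] (p : α → ℝ) (hp : ∑ a, p a = 1) (n : ℕ)
    (f : Fin n → α → ℝ) (hf : ∀ i, ∑ a, p a * f i a = 0) :
    (∑ σ : Fin n → α, ∏ i, p (σ i)) = 1 ∧
      (∑ σ : Fin n → α, (∏ i, p (σ i)) * ∑ i, f i (σ i)) = 0 ∧
      (∑ σ : Fin n → α, (∏ i, p (σ i)) * (∑ i, f i (σ i)) ^ 2) = ∑ i, ∑ a, p a * f i a ^ 2 := by
  induction n with
  | zero => simp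
  | succ n ih =>
    obtain ⟨h0, h1, h2⟩ := ih (fun i => f i.succ) fun i => hf i.succ
    have hsplit : ∀ g : (Fin (n + 1) → α) → ℝ,
        ∑ σ, g σ = ∑ a, ∑ σ : Fin n → α, g (Fin.cons a σ) := fun g => by
      rw [← (Fin.consEquiv fun _ : Fin (n + 1) => α).sum_comp, Fintype.sum_prod_type]
      rfl
    refine ⟨?_, ?_, ?_⟩
    · rw [hsplit]
      simp only [Fin.prod_univ_succ, Fin.cons_zero, Fin.cons_succ, ← Finset.mul_sum, h0, hp,
        mul_one]
    · rw [hsplit]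
      simp only [Fin.prod_univ_succ, Fin.sum_univ_succ, Fin.cons_zero, Fin.cons_succ]
      have : ∀ a, ∑ σ : Fin n → α, p a * (∏ i, p (σ i)) * (f 0 a + ∑ i : Fin n, f i.succ (σ i)) =
          p a * f 0 a := fun a => by
        simp only [mul_add, Finset.sum_add_distrib, mul_assoc, ← Finset.mul_sum, h1]
        rw [← Finset.sum_mul, h0]
        ring
      rw [Finset.sum_congr rfl fun a _ => this a, hf 0]
    · rw [hsplit, Fin.sum_univ_succ]
      simp only [Fin.prod_univ_succ, Fin.sum_univ_succ, Fin.cons_zero, Fin.cons_succ]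
      have : ∀ a, ∑ σ : Fin n → α,
          p a * (∏ i, p (σ i)) * (f 0 a + ∑ i : Fin n, f i.succ (σ i)) ^ 2 =
          p a * f 0 a ^ 2 + p a * ∑ i : Fin n, ∑ a, p a * f i.succ a ^ 2 := fun a => by
        have e : ∀ σ : Fin n → α,
            p a * (∏ i, p (σ i)) * (f 0 a + ∑ i : Fin n, f i.succ (σ i)) ^ 2 =
            p a * f 0 a ^ 2 * (∏ i, p (σ i)) +
              2 * p a * f 0 a * ((∏ i, p (σ i)) * ∑ i : Fin n, f i.succ (σ i)) +
              p a * ((∏ i, p (σ i)) * (∑ i : Fin n, f i.succ (σ i)) ^ 2) := fun σ => by ring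
        simp_rw [e, Finset.sum_add_distrib, ← Finset.mul_sum, h0, h1, h2]
        ring
      rw [Finset.sum_congr rfl fun a _ => this a, Finset.sum_add_distrib, ← Finset.sum_mul, hp,
        one_mul]

/-- The Fisher information is the sum of the second moments of the sample scores, as those are
independent and centred. -/
lemma dotProduct_fisherInfo_mulVec {m n : ℕ} {K : Matrix (Fin m) (Fin m) ℂ} (hK : K.PosDef)
    (W : Matrix (Fin m) (Fin n) ℂ) (v : Fin 2 → ℝ) :
    v ⬝ᵥ (fisherInfo K W 0 *ᵥ v) = ∑ i, ∑ σ : Fin m ⊕ Fin m → ℤˣ,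
      patternProb (realCov K) (signVec σ) *
        (v ⬝ᵥ sampleScore K (W.col i) (signVec σ)) ^ 2 := by
  rw [← (sum_prod_mul_sum (fun σ : Fin m ⊕ Fin m → ℤˣ => patternProb (realCov K) (signVec σ))
    (sum_patternProb (posDef_realCov hK)) n _
    fun i => sum_patternProb_mul_dotProduct_sampleScore hK (W.col i) v).2.2]
  rw [fisherInfo, Matrix.sum_mulVec, dotProduct_sum]
  refine Finset.sum_congr rfl fun σ _ => ?_
  change v ⬝ᵥ (((∏ i, sampleLikelihood K (W.col i) (signVec (σ i)) 0) •
    Matrix.vecMulVec (score K W (fun i => signVec (σ i)) 0)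
      (score K W (fun i => signVec (σ i)) 0)) *ᵥ v) = _
  simp_rw [sampleLikelihood_zero hK, score_zero hK, ← dotProduct_sum]
  rw [Matrix.smul_mulVec, dotProduct_smul, smul_eq_mul, Matrix.vecMulVec_mulVec]
  simp only [dotProduct_smul, op_smul_eq_smul, smul_eq_mul]
  rw [dotProduct_comm (∑ i, _) v, pow_two]

lemma isHermitian_fisherInfo {m n : ℕ} (K : Matrix (Fin m) (Fin m) ℂ)
    (W : Matrix (Fin m) (Fin n) ℂ) (θ : Fin 2 → ℝ) : (fisherInfo K W θ).IsHermitian := by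
  ext i j
  simp only [fisherInfo, Matrix.conjTranspose_apply, Matrix.sum_apply, Matrix.smul_apply,
    Matrix.vecMulVec_apply, star_trivial]
  exact Finset.sum_congr rfl fun σ _ => by rw [mul_comm (score _ _ _ _ j)]

/-- The Fisher information dominates a fixed multiple of the signal energy. -/
lemma exists_energy_le_fisherInfo {m : ℕ} {K : Matrix (Fin m) (Fin m) ℂ} (hK : K.PosDef) :
    ∃ c : ℝ, 0 < c ∧ ∀ (n : ℕ) (W : Matrix (Fin m) (Fin n) ℂ) (v : Fin 2 → ℝ),
      c * (∑ i, energy W i) * (v ⬝ᵥ v) ≤ v ⬝ᵥ (fisherInfo K W 0 *ᵥ v) := by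
  obtain ⟨c, hc, h⟩ := exists_le_sum_patternProb_sq (posDef_realCov hK)
  refine ⟨c, hc, fun n W v => ?_⟩
  rw [dotProduct_fisherInfo_mulVec hK, Finset.mul_sum, Finset.sum_mul]
  refine Finset.sum_le_sum fun i _ => ?_
  simp_rw [dotProduct_sampleScore]
  refine le_trans (le_of_eq ?_) (h _)
  rw [dotProduct_stack_smul]
  simp only [energy, Matrix.col_apply]
  ring

lemma exists_sq_sampleScore_le_energy {m : ℕ} (K : Matrix (Fin m) (Fin m) ℂ) :
    ∃ C : ℝ, 0 < C ∧ ∀ (n : ℕ) (W : Matrix (Fin m) (Fin n) ℂ) (i : Fin n)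
      (σ : Fin m ⊕ Fin m → ℤˣ),
      sampleScore K (W.col i) (signVec σ) ⬝ᵥ sampleScore K (W.col i) (signVec σ) ≤
        C * energy W i := by
  obtain ⟨C, hC, h⟩ := exists_sq_dotProduct_condScore_le (realCov K)
  refine ⟨2 * C, by positivity, fun n W i σ => ?_⟩
  have hk : ∀ k, sampleScore K (W.col i) (signVec σ) k ^ 2 ≤ C * energy W i := fun k => by
    refine (h σ (meanDeriv (W.col i) k)).trans (le_of_eq ?_)
    have := dotProduct_stack_smul (W.col i) (Pi.single k 1)
    congr 1
    fin_cases k <;> simpa [energy] using this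
  simp only [dotProduct, Fin.sum_univ_two]
  linarith [hk 0, hk 1]

/-! ### A central limit theorem for finitely valued triangular arrays -/

lemma norm_prod_sub_prod_le {α : Type*} (s : Finset α) (a b : α → ℂ) (ha : ∀ i, ‖a i‖ ≤ 1)
    (hb : ∀ i, ‖b i‖ ≤ 1) : ‖∏ i ∈ s, a i - ∏ i ∈ s, b i‖ ≤ ∑ i ∈ s, ‖a i - b i‖ := by
  classical
  induction s using Finset.induction_on with
  | empty => simp
  | insert j s hj ih =>
    rw [Finset.prod_insert hj, Finset.prod_insert hj, Finset.sum_insert hj,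
      show a j * ∏ i ∈ s, a i - b j * ∏ i ∈ s, b i =
        (a j - b j) * ∏ i ∈ s, a i + b j * (∏ i ∈ s, a i - ∏ i ∈ s, b i) by ring]
    have h1 : ‖∏ i ∈ s, a i‖ ≤ 1 := by
      rw [norm_prod]
      exact Finset.prod_le_one (fun i _ => norm_nonneg _) fun i _ => ha i
    refine (norm_add_le _ _).trans (add_le_add ?_ ?_)
    · rw [norm_mul]
      exact mul_le_of_le_one_right (norm_nonneg _) h1
    · rw [norm_mul]
      exact (mul_le_of_le_one_left (norm_nonneg _) (hb j)).trans ih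

/-- The characteristic function of a centred and uniformly small random variable with finitely
many values is close to that of the centred Gaussian with the same variance. -/
lemma norm_sum_mul_exp_sub_exp_le {α : Type*} [Fintype α] (p x : α → ℝ) (hp : ∀ a, 0 ≤ p a)
    (hp1 : ∑ a, p a = 1) (hx0 : ∑ a, p a * x a = 0) {ε : ℝ} (hε1 : ε ≤ 1)
    (hx : ∀ a, |x a| ≤ ε) :
    ‖∑ a, (p a : ℂ) * Complex.exp (x a * Complex.I) -
      Complex.exp (-((∑ a, p a * x a ^ 2 : ℝ) : ℂ) / 2)‖ ≤ ε * ∑ a, p a * x a ^ 2 := by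
  set V := ∑ a, p a * x a ^ 2 with hV
  have hV0 : 0 ≤ V := Finset.sum_nonneg fun a _ => mul_nonneg (hp a) (sq_nonneg _)
  obtain ⟨a₀⟩ : Nonempty α := by
    by_contra h
    rw [not_nonempty_iff] at h
    simp at hp1
  have hε0 : 0 ≤ ε := (abs_nonneg _).trans (hx a₀)
  have hVε : V ≤ ε ^ 2 := by
    calc V ≤ ∑ a, p a * ε ^ 2 := Finset.sum_le_sum fun a _ =>
          mul_le_mul_of_nonneg_left (sq_le_sq' (neg_le_of_abs_le (hx a)) (le_of_abs_le (hx a)))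
            (hp a)
      _ = ε ^ 2 := by rw [← Finset.sum_mul, hp1, one_mul]
  -- both terms are close to `1 - V / 2`: the first by the third-order Taylor bound for `exp (i x)`
  have h1 : ‖∑ a, (p a : ℂ) * Complex.exp (x a * Complex.I) - (1 - V / 2 : ℝ)‖ ≤
      ε * V * (2 / 9) := by
    have e : ∑ a, (p a : ℂ) * Complex.exp (x a * Complex.I) - (1 - V / 2 : ℝ) =
        ∑ a, (p a : ℂ) * (Complex.exp (x a * Complex.I) -
          ∑ k ∈ Finset.range 3, ((x a : ℂ) * Complex.I) ^ k / (Nat.factorial k : ℂ)) := by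
      have h2 : ∀ a, (p a : ℂ) * (Complex.exp (x a * Complex.I) -
          ∑ k ∈ Finset.range 3, ((x a : ℂ) * Complex.I) ^ k / (Nat.factorial k : ℂ)) =
          (p a : ℂ) * Complex.exp (x a * Complex.I) - ((p a : ℝ) : ℂ)
            - Complex.I * ((p a * x a : ℝ) : ℂ) + ((p a * x a ^ 2 : ℝ) : ℂ) / 2 := fun a => by
        simp only [Finset.sum_range_succ, Finset.sum_range_zero, Nat.factorial, mul_pow,
          Complex.I_sq]
        push_cast
        ring
      simp_rw [h2, Finset.sum_add_distrib, Finset.sum_sub_distrib, ← Finset.mul_sum,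
        ← Finset.sum_div, ← Complex.ofReal_sum, hp1, hx0, ← hV]
      push_cast
      ring
    rw [e]
    refine (norm_sum_le _ _).trans ?_
    rw [mul_comm ε V, hV, Finset.sum_mul, Finset.sum_mul]
    refine Finset.sum_le_sum fun a _ => ?_
    rw [norm_mul, Complex.norm_real, Real.norm_of_nonneg (hp a)]
    have hb := Complex.exp_bound (x := (x a : ℂ) * Complex.I)
      (by simpa using (hx a).trans hε1) (n := 3) (by norm_num)
    have hn : ‖(x a : ℂ) * Complex.I‖ = |x a| := by simp
    rw [hn] at hb
    have h3 : |x a| ^ 3 ≤ x a ^ 2 * ε := by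
      rw [pow_succ, sq_abs]
      exact mul_le_mul_of_nonneg_left (hx a) (sq_nonneg _)
    have h4 : (((Nat.succ 3 : ℕ) : ℝ) * ((Nat.factorial 3 : ℕ) * (3 : ℕ) : ℝ)⁻¹) = 2 / 9 := by
      norm_num [Nat.factorial]
    rw [h4] at hb
    calc p a * _ ≤ p a * (x a ^ 2 * ε * (2 / 9)) :=
          mul_le_mul_of_nonneg_left (hb.trans (by linarith)) (hp a)
      _ = p a * x a ^ 2 * ε * (2 / 9) := by ring
  have h2 : ‖((1 - V / 2 : ℝ) : ℂ) - Complex.exp (-(V : ℂ) / 2)‖ ≤ ε * V * (1 / 4) := by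
    have hcast : ((1 - V / 2 : ℝ) : ℂ) - Complex.exp (-(V : ℂ) / 2) =
        ((-(Real.exp (-V / 2) - 1 - (-V / 2)) : ℝ) : ℂ) := by
      push_cast
      ring
    rw [hcast, Complex.norm_real, norm_neg, Real.norm_eq_abs]
    refine (Real.abs_exp_sub_one_sub_id_le ?_).trans ?_
    · rw [abs_le]; constructor <;> nlinarith
    · nlinarith [mul_nonneg hε0 hV0, mul_le_mul_of_nonneg_left hVε hV0,
        mul_nonneg (mul_nonneg hε0 hV0) (sub_nonneg.mpr hε1)]
  calc _ ≤ _ := norm_sub_le_norm_sub_add_norm_sub _ ((1 - V / 2 : ℝ) : ℂ) _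
    _ ≤ ε * V * (2 / 9) + ε * V * (1 / 4) := add_le_add h1 h2
    _ ≤ ε * V := by nlinarith [mul_nonneg hε0 hV0]

/-- A quantitative central limit theorem for independent centred summands with finitely many
values, in terms of characteristic functions. -/
lemma norm_prod_sum_mul_exp_sub_exp_le {α β : Type*} [Fintype α] [Fintype β] (p : α → ℝ)
    (x : β → α → ℝ) (hp : ∀ a, 0 ≤ p a) (hp1 : ∑ a, p a = 1) (hx0 : ∀ i, ∑ a, p a * x i a = 0)
    {ε : ℝ} (hε1 : ε ≤ 1) (hx : ∀ i a, |x i a| ≤ ε) :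
    ‖∏ i, ∑ a, (p a : ℂ) * Complex.exp (x i a * Complex.I) -
      Complex.exp (-((∑ i, ∑ a, p a * x i a ^ 2 : ℝ) : ℂ) / 2)‖ ≤
        ε * ∑ i, ∑ a, p a * x i a ^ 2 := by
  have hexp : Complex.exp (-((∑ i, ∑ a, p a * x i a ^ 2 : ℝ) : ℂ) / 2) =
      ∏ i, Complex.exp (-((∑ a, p a * x i a ^ 2 : ℝ) : ℂ) / 2) := by
    rw [← Complex.exp_sum, ← Finset.sum_div, Finset.sum_neg_distrib, Complex.ofReal_sum]
  rw [hexp, Finset.mul_sum]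
  refine (norm_prod_sub_prod_le _ _ _ (fun i => ?_) fun i => ?_).trans
    (Finset.sum_le_sum fun i _ => norm_sum_mul_exp_sub_exp_le p (x i) hp hp1 (hx0 i) hε1 (hx i))
  · refine (norm_sum_le _ _).trans (le_of_eq ?_)
    rw [← hp1]
    refine Finset.sum_congr rfl fun a _ => ?_
    rw [norm_mul, Complex.norm_exp_ofReal_mul_I, mul_one, Complex.norm_real,
      Real.norm_of_nonneg (hp a)]
  · rw [Complex.norm_exp]
    refine Real.exp_le_one_iff.mpr ?_
    have : (-((∑ a, p a * x i a ^ 2 : ℝ) : ℂ) / 2).re = -(∑ a, p a * x i a ^ 2) / 2 := by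
      rw [Complex.div_ofNat_re, Complex.neg_re, Complex.ofReal_re]
    rw [this]
    have := Finset.sum_nonneg fun (a : α) (_ : a ∈ Finset.univ) =>
      mul_nonneg (hp a) (sq_nonneg (x i a))
    linarith

/-! ### The chi-squared distribution with two degrees of freedom -/

/-- The squared characteristic function of the square of a standard Gaussian variable. Squaring
removes the branch of the complex square root. -/
lemma integral_gaussianReal_exp_sq (t : ℝ) :
    (∫ x, Complex.exp (((t * x ^ 2 : ℝ) : ℂ) * Complex.I) ∂gaussianReal 0 1) ^ 2 =
      1 / 2 / (1 / 2 - t * Complex.I) := by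
  set b : ℂ := 1 / 2 - t * Complex.I with hb
  have hbre : 0 < b.re := by simp [hb]
  have hb0 : b ≠ 0 := fun h => by simp [h] at hbre
  rw [integral_gaussianReal_eq_integral_smul one_ne_zero]
  have h : ∀ x : ℝ, gaussianPDFReal 0 1 x • Complex.exp (((t * x ^ 2 : ℝ) : ℂ) * Complex.I) =
      (((√(2 * Real.pi))⁻¹ : ℝ) : ℂ) * Complex.exp (-b * (x : ℂ) ^ 2) := fun x => by
    rw [gaussianPDFReal, Complex.real_smul, Complex.ofReal_mul, mul_assoc, Complex.ofReal_exp,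
      ← Complex.exp_add]
    congr 2
    · simp
    · simp only [hb]
      push_cast
      ring
  simp_rw [h]
  rw [integral_const_mul, integral_gaussian_complex hbre, mul_pow, ← Complex.cpow_nat_mul,
    ← Complex.ofReal_pow, inv_pow, Real.sq_sqrt (by positivity)]
  have hpi : (Real.pi : ℂ) ≠ 0 := by exact_mod_cast Real.pi_ne_zero
  norm_num
  field_simp

lemma charFun_chiSquared_two (t : ℝ) :
    charFun (chiSquared 2) t = 1 / 2 / (1 / 2 - t * Complex.I) := by
  rw [charFun_apply_real, chiSquared, integral_map (Finset.measurable_sum _ fun i _ =>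
    (measurable_pi_apply i).pow_const 2).aemeasurable (by fun_prop)]
  have : ∀ z : Fin 2 → ℝ, Complex.exp (t * ((∑ i, z i ^ 2 : ℝ) : ℂ) * Complex.I) =
      ∏ i, Complex.exp (((t * z i ^ 2 : ℝ) : ℂ) * Complex.I) := fun z => by
    rw [← Complex.exp_sum, ← Finset.sum_mul, ← Complex.ofReal_sum, ← Finset.mul_sum,
      Complex.ofReal_mul]
  simp_rw [this]
  rw [integral_fintype_prod_eq_prod
    (f := fun (_ : Fin 2) (x : ℝ) => Complex.exp (((t * x ^ 2 : ℝ) : ℂ) * Complex.I)),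
    Finset.prod_const, Finset.card_univ, Fintype.card_fin, integral_gaussianReal_exp_sq]

lemma charFun_expMeasure {r : ℝ} (hr : 0 < r) (t : ℝ) :
    charFun (expMeasure r) t = r / (r - t * Complex.I) := by
  have hpdf : expMeasure r = volume.withDensity fun x => ENNReal.ofReal (exponentialPDFReal r x) :=
    rfl
  rw [charFun_apply_real, hpdf, integral_withDensity_eq_integral_toReal_smul
    (measurable_exponentialPDFReal r).ennreal_ofReal (by simp)]
  have h : ∀ x : ℝ, (ENNReal.ofReal (exponentialPDFReal r x)).toReal •
      Complex.exp (t * x * Complex.I) = (Set.Ici (0 : ℝ)).indicator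
        (fun x : ℝ => (r : ℂ) * Complex.exp ((-r + t * Complex.I) * x)) x := fun x => by
    by_cases hx : 0 ≤ x
    · have hx' := exponentialPDF_of_nonneg (r := r) hx
      rw [exponentialPDF] at hx'
      rw [hx', ENNReal.toReal_ofReal (by positivity), Set.indicator_of_mem (Set.mem_Ici.mpr hx),
        Complex.real_smul, Complex.ofReal_mul, mul_assoc, Complex.ofReal_exp, ← Complex.exp_add]
      congr 2
      push_cast
      ring
    · have hx' := exponentialPDF_of_neg (r := r) (not_le.mp hx)
      rw [exponentialPDF] at hx'
      rw [hx', Set.indicator_of_notMem (by simpa using hx)]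
      simp
  simp_rw [h]
  rw [integral_indicator measurableSet_Ici, integral_Ici_eq_integral_Ioi, integral_const_mul,
    integral_exp_mul_complex_Ioi (by simpa using hr)]
  have h1 : (r : ℂ) - t * Complex.I ≠ 0 := fun h => by
    have := congrArg Complex.re h
    simp at this
    exact hr.ne' this
  have h2 : -(r : ℂ) + t * Complex.I ≠ 0 := fun h => h1 (by linear_combination -h)
  simp only [Complex.ofReal_zero, mul_zero, Complex.exp_zero]
  field_simp
  ring

lemma chiSquared_two_eq_expMeasure : chiSquared 2 = expMeasure (1 / 2) := by
  have := isProbabilityMeasure_expMeasure (r := 1 / 2) (by norm_num)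
  refine Measure.ext_of_charFun (funext fun t => ?_)
  rw [charFun_chiSquared_two, charFun_expMeasure (by norm_num)]
  push_cast
  rfl

/-! ### The score as a sum of independent vectors -/

lemma measurable_patternFun {ι : Type*} [Fintype ι] [DecidableEq ι] {E : Type*} [AddCommMonoid E]
    [MeasurableSpace E] [MeasurableAdd₂ E] (f : (ι → ℤˣ) → E) : Measurable (patternFun f) := by
  unfold patternFun
  exact Finset.measurable_sum _ fun σ _ => measurable_const.indicator (measurableSet_orthant _)

lemma measurable_stack {m : ℕ} : Measurable (stack : (Fin m → ℂ) → Fin m ⊕ Fin m → ℝ) := by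
  refine measurable_pi_iff.mpr fun j => ?_
  rcases j with j | j
  · exact Complex.measurable_re.comp (measurable_pi_apply j)
  · exact Complex.measurable_im.comp (measurable_pi_apply j)

lemma sign_eq_signVec {ι : Type*} {σ : ι → ℤˣ} {x : ι → ℝ} (hx : x ∈ orthant (signVec σ))
    (j : ι) : Real.sign (x j) = signVec σ j := by
  have h := hx j
  rcases Int.units_eq_one_or (σ j) with h1 | h1
  · simp only [signVec, h1, Units.val_one, Int.cast_one, one_mul] at h ⊢
    exact Real.sign_of_pos h
  · simp only [signVec, h1, Units.val_neg, Units.val_one, Int.cast_neg, Int.cast_one, neg_mul,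
      one_mul] at h ⊢
    exact Real.sign_of_neg (by linarith)

/-- Off the coordinate hyperplanes, the one-bit data are the sign pattern of the noise. -/
lemma stack_quantize_col {m n : ℕ} (X : Matrix (Fin m) (Fin n) ℂ) (i : Fin n)
    {σ : Fin m ⊕ Fin m → ℤˣ} (hσ : stack (X.col i) ∈ orthant (signVec σ)) :
    stack ((quantize X).col i) = signVec σ := by
  funext j
  rw [← sign_eq_signVec hσ j]
  rcases j with j | j <;> simp [stack, quantize, Matrix.col]

lemma sum_energy_pos {m n : ℕ} {W : Matrix (Fin m) (Fin n) ℂ} (hW : W ≠ 0) :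
    0 < ∑ i, energy W i := by
  obtain ⟨j, i, hji⟩ : ∃ j i, W j i ≠ 0 := by
    by_contra! h
    exact hW (Matrix.ext h)
  have hnn : ∀ i, 0 ≤ energy W i := fun i => Finset.sum_nonneg fun j _ => sq_nonneg _
  exact Finset.sum_pos' (fun i _ => hnn i) ⟨i, Finset.mem_univ _,
    Finset.sum_pos' (fun j _ => sq_nonneg _)
      ⟨j, Finset.mem_univ _, pow_pos (norm_pos_iff.mpr hji) 2⟩⟩

lemma posDef_fisherInfo {m n : ℕ} {K : Matrix (Fin m) (Fin m) ℂ} (hK : K.PosDef)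
    {W : Matrix (Fin m) (Fin n) ℂ} (hW : W ≠ 0) : (fisherInfo K W 0).PosDef := by
  obtain ⟨c, hc, h⟩ := exists_energy_le_fisherInfo hK
  refine Matrix.PosDef.of_dotProduct_mulVec_pos (isHermitian_fisherInfo K W 0) fun {v} hv => ?_
  rw [star_trivial]
  have hvv : 0 < v ⬝ᵥ v := by
    have := Matrix.PosDef.one.dotProduct_mulVec_pos hv
    rwa [Matrix.one_mulVec, star_trivial] at this
  exact (mul_pos (mul_pos hc (sum_energy_pos hW)) hvv).trans_le (h n W v)

/-- If `F ≥ c` as quadratic forms then `F⁻¹ ≤ c⁻¹`. -/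
lemma mul_dotProduct_inv_mulVec_le {κ : Type*} [Fintype κ] [DecidableEq κ] {F : Matrix κ κ ℝ}
    (hF : F.PosDef) {c : ℝ} (hc : 0 < c) (h : ∀ v : κ → ℝ, c * (v ⬝ᵥ v) ≤ v ⬝ᵥ (F *ᵥ v))
    (s : κ → ℝ) : c * (s ⬝ᵥ (F⁻¹ *ᵥ s)) ≤ s ⬝ᵥ s := by
  set z := F⁻¹ *ᵥ s with hz
  have hFz : F *ᵥ z = s := by
    rw [hz, Matrix.mulVec_mulVec, Matrix.mul_nonsing_inv _ hF.det_pos.ne'.isUnit,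
      Matrix.one_mulVec]
  have h1 := h z
  rw [hFz, dotProduct_comm z s] at h1
  -- expand `|s - c z|² ≥ 0`
  have h2 : 0 ≤ (s - c • z) ⬝ᵥ (s - c • z) := Finset.sum_nonneg fun j _ => mul_self_nonneg _
  simp only [sub_dotProduct, dotProduct_sub, smul_dotProduct, dotProduct_smul, smul_eq_mul,
    dotProduct_comm z s] at h2
  nlinarith

section Model

variable {m n : ℕ} {K : Matrix (Fin m) (Fin m) ℂ} {Ω : Type*} [MeasurableSpace Ω] {P : Measure Ω}

lemma hasLaw_stack {Z : Ω → Fin m → ℂ} (h : IsCircularGaussian Z K P) :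
    HasLaw (fun ω => stack (Z ω)) (gaussianPi (realCov K)) P where
  aemeasurable := (by fun_prop : Measurable (WithLp.ofLp (p := 2)
    (V := Fin m ⊕ Fin m → ℝ))).comp_aemeasurable h.aemeasurable
  map_eq := by
    rw [gaussianPi, ← h.map_eq, AEMeasurable.map_map_of_aemeasurable (by fun_prop) h.aemeasurable]
    rfl

/-- The contribution of snapshot `i` to the score at `θ = 0`, as a measurable function of the
unquantized noise. -/
def noiseScore (K : Matrix (Fin m) (Fin m) ℂ) (W : Matrix (Fin m) (Fin n) ℂ)
    (X : Matrix (Fin m) (Fin n) ℂ) (i : Fin n) : Fin 2 → ℝ :=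
  patternFun (fun σ => sampleScore K (W.col i) (signVec σ)) (stack (X.col i))

lemma ae_score_eq (hK : K.PosDef) (W : Matrix (Fin m) (Fin n) ℂ)
    {N : Ω → Matrix (Fin m) (Fin n) ℂ}
    (hlaw : ∀ i, IsCircularGaussian (fun ω => (N ω).col i) K P) :
    ∀ᵐ ω ∂P, score K W (fun i => stack ((quantize (N ω)).col i)) 0 =
      ∑ i, noiseScore K W (N ω) i := by
  have h : ∀ᵐ ω ∂P, ∀ i, ∃ σ : Fin m ⊕ Fin m → ℤˣ,
      stack ((N ω).col i) ∈ orthant (signVec σ) := by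
    refine ae_all_iff.mpr fun i => ?_
    have hl := hasLaw_stack (hlaw i)
    refine ae_of_ae_map (p := fun x => ∃ σ : Fin m ⊕ Fin m → ℤˣ, x ∈ orthant (signVec σ))
      hl.aemeasurable ?_
    rw [hl.map_eq]
    exact ae_exists_mem_orthant (posDef_realCov hK)
  filter_upwards [h] with ω hω
  choose σ hσ using hω
  have hq : (fun i => stack ((quantize (N ω)).col i)) = fun i => signVec (σ i) :=
    funext fun i => stack_quantize_col _ _ (hσ i)
  rw [hq, score_zero hK]
  exact Finset.sum_congr rfl fun i _ => (patternFun_of_mem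
    (fun τ => sampleScore K (W.col i) (signVec τ)) (hσ i)).symm

lemma aemeasurable_noiseScore (W : Matrix (Fin m) (Fin n) ℂ)
    {N : Ω → Matrix (Fin m) (Fin n) ℂ}
    (hlaw : ∀ i, IsCircularGaussian (fun ω => (N ω).col i) K P) (i : Fin n) :
    AEMeasurable (fun ω => noiseScore K W (N ω) i) P :=
  (measurable_patternFun _).comp_aemeasurable (hasLaw_stack (hlaw i)).aemeasurable

/-- The score vector, normalized by a matrix `R`. -/
def normalizedScore (K : Matrix (Fin m) (Fin m) ℂ) (W : Matrix (Fin m) (Fin n) ℂ)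
    (R : Matrix (Fin 2) (Fin 2) ℝ) (X : Matrix (Fin m) (Fin n) ℂ) : EuclideanSpace ℝ (Fin 2) :=
  ∑ i, WithLp.toLp 2 (R *ᵥ noiseScore K W X i)

lemma aemeasurable_toLp_mulVec_noiseScore (W : Matrix (Fin m) (Fin n) ℂ)
    (R : Matrix (Fin 2) (Fin 2) ℝ) {N : Ω → Matrix (Fin m) (Fin n) ℂ}
    (hlaw : ∀ i, IsCircularGaussian (fun ω => (N ω).col i) K P) (i : Fin n) :
    AEMeasurable (fun ω => WithLp.toLp 2 (R *ᵥ noiseScore K W (N ω) i)) P :=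
  ((WithLp.measurable_toLp 2 _).comp (measurable_mulVec R)).comp_aemeasurable
    (aemeasurable_noiseScore W hlaw i)

lemma norm_sq_normalizedScore (W : Matrix (Fin m) (Fin n) ℂ) {R F : Matrix (Fin 2) (Fin 2) ℝ}
    (hR : F⁻¹ = Rᵀ * R) (X : Matrix (Fin m) (Fin n) ℂ) :
    ‖normalizedScore K W R X‖ ^ 2 =
      (∑ i, noiseScore K W X i) ⬝ᵥ (F⁻¹ *ᵥ ∑ i, noiseScore K W X i) := by
  have h : normalizedScore K W R X = WithLp.toLp 2 (R *ᵥ ∑ i, noiseScore K W X i) := by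
    rw [normalizedScore, Matrix.mulVec_sum, WithLp.toLp_sum]
  rw [h, hR, ← Matrix.mulVec_mulVec, Matrix.dotProduct_mulVec, Matrix.vecMul_transpose,
    EuclideanSpace.real_norm_sq_eq]
  simp only [dotProduct, pow_two]

lemma charFun_normalizedScore (hK : K.PosDef) (W : Matrix (Fin m) (Fin n) ℂ)
    (R : Matrix (Fin 2) (Fin 2) ℝ) {N : Ω → Matrix (Fin m) (Fin n) ℂ}
    (hindep : iIndepFun (fun (i : Fin n) ω => (N ω).col i) P)
    (hlaw : ∀ i, IsCircularGaussian (fun ω => (N ω).col i) K P) (t : EuclideanSpace ℝ (Fin 2)) :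
    charFun (P.map fun ω => normalizedScore K W R (N ω)) t =
      ∏ i, ∑ σ : Fin m ⊕ Fin m → ℤˣ, (patternProb (realCov K) (signVec σ) : ℂ) *
        Complex.exp ((((Rᵀ *ᵥ t.ofLp) ⬝ᵥ sampleScore K (W.col i) (signVec σ) : ℝ) : ℂ) *
          Complex.I) := by
  have hind : iIndepFun (fun (i : Fin n) ω => WithLp.toLp 2 (R *ᵥ noiseScore K W (N ω) i)) P :=
    hindep.comp (fun i x => WithLp.toLp 2 (R *ᵥ
      patternFun (fun σ => sampleScore K (W.col i) (signVec σ)) (stack x))) fun i =>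
        (WithLp.measurable_toLp 2 _).comp ((measurable_mulVec R).comp
          ((measurable_patternFun _).comp measurable_stack))
  simp only [normalizedScore]
  rw [hind.charFun_map_fun_sum_eq_prod fun i => aemeasurable_toLp_mulVec_noiseScore W R hlaw i,
    Finset.prod_apply]
  refine Finset.prod_congr rfl fun i _ => ?_
  rw [charFun_apply, integral_map (aemeasurable_toLp_mulVec_noiseScore W R hlaw i) (by fun_prop)]
  have hinner : ∀ s : Fin 2 → ℝ, inner ℝ (WithLp.toLp 2 (R *ᵥ s)) t = (Rᵀ *ᵥ t.ofLp) ⬝ᵥ s :=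
    fun s => by
      rw [EuclideanSpace.inner_eq_star_dotProduct, star_trivial, Matrix.dotProduct_mulVec,
        ← Matrix.mulVec_transpose]
  simp_rw [hinner]
  have hl := hasLaw_stack (hlaw i)
  let f : (Fin m ⊕ Fin m → ℝ) → ℂ := fun x => Complex.exp ((((Rᵀ *ᵥ t.ofLp) ⬝ᵥ
    patternFun (fun σ => sampleScore K (W.col i) (signVec σ)) x : ℝ) : ℂ) * Complex.I)
  have hf : Measurable f := by
    have h1 : Continuous fun v : Fin 2 → ℝ =>
        Complex.exp ((((Rᵀ *ᵥ t.ofLp) ⬝ᵥ v : ℝ) : ℂ) * Complex.I) := by fun_prop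
    exact h1.measurable.comp (measurable_patternFun _)
  have hint : Integrable f (gaussianPi (realCov K)) :=
    (integrable_const (1 : ℝ)).mono' hf.aestronglyMeasurable
      (ae_of_all _ fun x => (Complex.norm_exp_ofReal_mul_I _).le)
  have h2 : ∫ ω, f (stack ((N ω).col i)) ∂P = ∫ x, f x ∂gaussianPi (realCov K) := by
    rw [← hl.map_eq, integral_map hl.aemeasurable hf.aestronglyMeasurable]
  refine h2.trans ?_
  rw [integral_pattern (posDef_realCov hK) (fun σ => Complex.exp ((((Rᵀ *ᵥ t.ofLp) ⬝ᵥ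
    sampleScore K (W.col i) (signVec σ) : ℝ) : ℂ) * Complex.I)) hint
    fun σ x hx => by simp only [f, patternFun_of_mem _ hx]]
  simp_rw [Complex.real_smul]

end Model

/-- The characteristic function of the normalized score is close to that of the standard Gaussian
when each snapshot carries a small part of the energy. -/
lemma exists_norm_charFun_normalizedScore_sub_le {m : ℕ} {K : Matrix (Fin m) (Fin m) ℂ}
    (hK : K.PosDef) :
    ∃ A : ℝ, 0 < A ∧ ∀ {n : ℕ} {W : Matrix (Fin m) (Fin n) ℂ} {R : Matrix (Fin 2) (Fin 2) ℝ}
      {Ω : Type*} [MeasurableSpace Ω] {P : Measure Ω}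
      {N : Ω → Matrix (Fin m) (Fin n) ℂ},
      W ≠ 0 → (fisherInfo K W 0)⁻¹ = Rᵀ * R →
      iIndepFun (fun (i : Fin n) ω => (N ω).col i) P →
      (∀ i, IsCircularGaussian (fun ω => (N ω).col i) K P) →
      ∀ (t : EuclideanSpace ℝ (Fin 2)) (ε δ : ℝ), 0 ≤ ε → ε ≤ 1 →
        (∀ i, energy W i ≤ δ * ∑ k, energy W k) → A * δ * ‖t‖ ^ 2 ≤ ε ^ 2 →
        ‖charFun (P.map fun ω => normalizedScore K W R (N ω)) t -
          Complex.exp (-((‖t‖ ^ 2 : ℝ) : ℂ) / 2)‖ ≤ ε * ‖t‖ ^ 2 := by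
  obtain ⟨c, hc, hF⟩ := exists_energy_le_fisherInfo hK
  obtain ⟨C, hC, hs⟩ := exists_sq_sampleScore_le_energy K
  refine ⟨C / c, div_pos hC hc, ?_⟩
  intro n W R Ω _ P N hW hR hindep hlaw t ε δ hε0 hε1 hδ hA
  set F := fisherInfo K W 0 with hFdef
  set E := ∑ k, energy W k with hE
  have hE0 : 0 < E := sum_energy_pos hW
  have hFpos : F.PosDef := posDef_fisherInfo hK hW
  have hFu : IsUnit F.det := hFpos.det_pos.ne'.isUnit
  have hRF : R * (F * Rᵀ) = 1 := by
    rw [mul_eq_one_comm, Matrix.mul_assoc, ← hR, Matrix.mul_nonsing_inv _ hFu]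
  have htt : t.ofLp ⬝ᵥ t.ofLp = ‖t‖ ^ 2 := by
    rw [EuclideanSpace.real_norm_sq_eq]
    simp only [dotProduct, pow_two]
  -- the covariance `R F Rᵀ` of the normalized score is the identity
  have hquad : (Rᵀ *ᵥ t.ofLp) ⬝ᵥ (F *ᵥ (Rᵀ *ᵥ t.ofLp)) = ‖t‖ ^ 2 := by
    rw [Matrix.mulVec_transpose R, ← Matrix.dotProduct_mulVec, ← Matrix.mulVec_transpose R,
      Matrix.mulVec_mulVec, Matrix.mulVec_mulVec, Matrix.mul_assoc, hRF, Matrix.one_mulVec, htt]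
  have hsum := dotProduct_fisherInfo_mulVec hK W (Rᵀ *ᵥ t.ofLp)
  rw [← hFdef, hquad] at hsum
  rw [charFun_normalizedScore hK W R hindep hlaw t, hsum]
  refine norm_prod_sum_mul_exp_sub_exp_le _ _ (fun σ => (patternProb_pos (posDef_realCov hK) σ).le)
    (sum_patternProb (posDef_realCov hK))
    (fun i => sum_patternProb_mul_dotProduct_sampleScore hK _ _) hε1 fun i σ => ?_
  set s := sampleScore K (W.col i) (signVec σ)
  refine abs_le_of_sq_le_sq ?_ hε0
  -- each summand is small: `⟨t, R s⟩² ≤ ‖t‖² (s ⬝ᵥ F⁻¹ s)` and `F⁻¹ ≤ (c E)⁻¹`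
  have h1 : ((Rᵀ *ᵥ t.ofLp) ⬝ᵥ s) ^ 2 ≤ ‖t‖ ^ 2 * (s ⬝ᵥ (F⁻¹ *ᵥ s)) := by
    rw [Matrix.mulVec_transpose, ← Matrix.dotProduct_mulVec, hR, ← Matrix.mulVec_mulVec,
      Matrix.dotProduct_mulVec s, Matrix.vecMul_transpose, ← htt]
    simpa only [dotProduct, ← pow_two] using
      Finset.sum_mul_sq_le_sq_mul_sq Finset.univ t.ofLp (R *ᵥ s)
  have h2 := mul_dotProduct_inv_mulVec_le hFpos (mul_pos hc hE0) (fun v => hF n W v) s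
  have h3 : c * E * (s ⬝ᵥ (F⁻¹ *ᵥ s)) ≤ c * E * (C / c * δ) := by
    calc _ ≤ C * energy W i := h2.trans (hs n W i σ)
      _ ≤ C * (δ * E) := mul_le_mul_of_nonneg_left (hδ i) hC.le
      _ = c * E * (C / c * δ) := by field_simp
  have h4 := le_of_mul_le_mul_left h3 (mul_pos hc hE0)
  calc _ ≤ _ := h1
    _ ≤ ‖t‖ ^ 2 * (C / c * δ) := mul_le_mul_of_nonneg_left h4 (sq_nonneg _)
    _ ≤ ε ^ 2 := by linarith

lemma map_norm_sq_stdGaussian (k : ℕ) :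
    (stdGaussian (EuclideanSpace ℝ (Fin k))).map (fun x => ‖x‖ ^ 2) = chiSquared k := by
  rw [← map_pi_eq_stdGaussian, Measure.map_map (by fun_prop) (by fun_prop), chiSquared]
  congr 1
  funext z
  simp [EuclideanSpace.real_norm_sq_eq]

lemma expMeasure_real_Ioi {r γ : ℝ} (hr : 0 < r) (hγ : 0 ≤ γ) :
    (expMeasure r).real (Set.Ioi γ) = Real.exp (-(r * γ)) := by
  have := isProbabilityMeasure_expMeasure hr
  rw [← Set.compl_Iic, probReal_compl_eq_one_sub measurableSet_Iic, ← cdf_eq_real,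
    cdf_expMeasure_eq hr, if_pos hγ]
  ring

open scoped MatrixOrder in
lemma _root_.Matrix.PosDef.exists_inv_eq_transpose_mul_self {κ : Type*} [Fintype κ]
    [DecidableEq κ] {F : Matrix κ κ ℝ} (hF : F.PosDef) : ∃ R : Matrix κ κ ℝ, F⁻¹ = Rᵀ * R := by
  refine ⟨CFC.sqrt F⁻¹, ?_⟩
  have := (CFC.sqrt_nonneg F⁻¹).isSelfAdjoint.star_eq
  rw [Matrix.star_eq_conjTranspose, Matrix.conjTranspose_eq_transpose_of_trivial] at this
  rw [this, CFC.sqrt_mul_sqrt_self _ hF.inv.posSemidef.nonneg]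

/-! ### Convergence of Rao's statistic -/

lemma tendstoInDistribution_raoStatistic {m : ℕ} {K : Matrix (Fin m) (Fin m) ℂ} (hK : K.PosDef)
    (W : (n : ℕ) → Matrix (Fin m) (Fin n) ℂ) (hW_ne : ∀ᶠ n in atTop, W n ≠ 0)
    (hW : ∀ ε : ℝ, 0 < ε → ∀ᶠ n in atTop, ∀ i : Fin n,
      energy (W n) i ≤ ε * ∑ k, energy (W n) k)
    {Ω : ℕ → Type*} [∀ n, MeasurableSpace (Ω n)] (P : (n : ℕ) → Measure (Ω n))
    [∀ n, IsProbabilityMeasure (P n)] (N : (n : ℕ) → Ω n → Matrix (Fin m) (Fin n) ℂ)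
    (hindep : ∀ n, iIndepFun (fun (i : Fin n) ω => (N n ω).col i) (P n))
    (hlaw : ∀ n, ∀ i : Fin n, IsCircularGaussian (fun ω => (N n ω).col i) K (P n)) :
    TendstoInDistribution (fun n ω => raoStatistic K (W n) (quantize (N n ω))) atTop id P
      (chiSquared 2) := by
  have hR : ∀ n, ∃ R : Matrix (Fin 2) (Fin 2) ℝ, W n ≠ 0 → (fisherInfo K (W n) 0)⁻¹ = Rᵀ * R :=
    fun n => by
      by_cases h : W n = 0
      · exact ⟨0, fun h' => absurd h h'⟩
      · obtain ⟨R, hR⟩ := (posDef_fisherInfo hK h).exists_inv_eq_transpose_mul_self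
        exact ⟨R, fun _ => hR⟩
  choose R hR using hR
  have hV : ∀ n, AEMeasurable (fun ω => ∑ i, noiseScore K (W n) (N n ω) i) (P n) := fun n =>
    Finset.aemeasurable_fun_sum _ fun i _ => aemeasurable_noiseScore (W n) (hlaw n) i
  have hG : ∀ n, AEMeasurable (fun ω => normalizedScore K (W n) (R n) (N n ω)) (P n) := fun n =>
    Finset.aemeasurable_fun_sum _ fun i _ =>
      aemeasurable_toLp_mulVec_noiseScore (W n) (R n) (hlaw n) i
  have hTV : ∀ n, (fun ω => raoStatistic K (W n) (quantize (N n ω))) =ᵐ[P n] fun ω =>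
      (∑ i, noiseScore K (W n) (N n ω) i) ⬝ᵥ
        ((fisherInfo K (W n) 0)⁻¹ *ᵥ ∑ i, noiseScore K (W n) (N n ω) i) := fun n => by
    filter_upwards [ae_score_eq hK (W n) (hlaw n)] with ω hω
    simp only [raoStatistic, hω]
  have hT : ∀ n, AEMeasurable (fun ω => raoStatistic K (W n) (quantize (N n ω))) (P n) := by
    intro n
    have h1 : Continuous fun v : Fin 2 → ℝ => v ⬝ᵥ ((fisherInfo K (W n) 0)⁻¹ *ᵥ v) := by
      fun_prop
    exact (h1.measurable.comp_aemeasurable (hV n)).congr (hTV n).symm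
  -- the central limit theorem for the normalized score, by Lévy's continuity theorem
  have hclt : TendstoInDistribution (fun n ω => normalizedScore K (W n) (R n) (N n ω)) atTop id P
      (stdGaussian (EuclideanSpace ℝ (Fin 2))) := by
    refine ⟨hG, by fun_prop, ProbabilityMeasure.tendsto_iff_tendsto_charFun.mpr fun t => ?_⟩
    obtain ⟨A, hA, hbound⟩ := exists_norm_charFun_normalizedScore_sub_le hK
    simp only [ProbabilityMeasure.coe_mk, Measure.map_id]
    rw [charFun_stdGaussian, Metric.tendsto_atTop']
    intro ε hε
    set η := min 1 (ε / (2 * (‖t‖ ^ 2 + 1))) with hη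
    have hη0 : 0 < η := lt_min one_pos (by positivity)
    have hηt : η * ‖t‖ ^ 2 < ε := by
      have h1 : η * (2 * (‖t‖ ^ 2 + 1)) ≤ ε :=
        (le_div_iff₀ (by positivity)).mp (min_le_right _ _)
      nlinarith [sq_nonneg ‖t‖, mul_nonneg hη0.le (sq_nonneg ‖t‖)]
    set δ := η ^ 2 / (A * (‖t‖ ^ 2 + 1)) with hδ
    have hδ0 : 0 < δ := by positivity
    have hδA : A * δ * ‖t‖ ^ 2 ≤ η ^ 2 := by
      have h1 : A * δ * (‖t‖ ^ 2 + 1) = η ^ 2 := by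
        rw [hδ]
        field_simp
      nlinarith [mul_pos hA hδ0]
    obtain ⟨n₀, hn₀⟩ := eventually_atTop.mp (hW_ne.and (hW δ hδ0))
    refine ⟨n₀, fun n hn => ?_⟩
    obtain ⟨h1, h2⟩ := hn₀ n hn.le
    have := hbound h1 (hR n h1) (hindep n) (hlaw n) t η δ hη0.le (min_le_left _ _) h2 hδA
    rw [dist_eq_norm]
    refine lt_of_le_of_lt ?_ hηt
    simpa using this
  -- the statistic is the squared norm of the normalized score as soon as `W n ≠ 0`
  have hsq := hclt.continuous_comp (g := fun x => ‖x‖ ^ 2) (by fun_prop)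
  refine ⟨hT, aemeasurable_id, ?_⟩
  have hlim : (⟨(stdGaussian (EuclideanSpace ℝ (Fin 2))).map ((fun x => ‖x‖ ^ 2) ∘ id),
      Measure.isProbabilityMeasure_map hsq.aemeasurable_limit⟩ : ProbabilityMeasure ℝ) =
      ⟨(chiSquared 2).map id, Measure.isProbabilityMeasure_map aemeasurable_id⟩ := by
    refine Subtype.ext ?_
    simp only [Measure.map_id, Function.comp_id]
    exact map_norm_sq_stdGaussian 2
  have ht := hsq.tendsto
  rw [hlim] at ht
  refine ht.congr' ?_
  filter_upwards [hW_ne] with n hn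
  refine Subtype.ext (Measure.map_congr ?_)
  filter_upwards [hTV n] with ω hω
  simp only [Function.comp_apply]
  rw [hω, norm_sq_normalizedScore (W n) (hR n hn)]

lemma tendsto_measureReal_Ioi_of_tendstoInDistribution {Ω : ℕ → Type*}
    [∀ n, MeasurableSpace (Ω n)] {P : (n : ℕ) → Measure (Ω n)} [∀ n, IsProbabilityMeasure (P n)]
    {T : (n : ℕ) → Ω n → ℝ} (hT : TendstoInDistribution T atTop id P (chiSquared 2)) {γ : ℝ}
    (hγ : 0 ≤ γ) :
    Tendsto (fun n => (P n).real {ω | γ < T n ω}) atTop (𝓝 (Real.exp (-γ / 2))) := by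
  have hatom : chiSquared 2 (frontier (Set.Ioi γ)) = 0 := by
    rw [chiSquared_two_eq_expMeasure, frontier_Ioi]
    exact withDensity_absolutelyContinuous _ _ (measure_singleton γ)
  have h := ProbabilityMeasure.tendsto_measure_of_null_frontier_of_tendsto' hT.tendsto
    (E := Set.Ioi γ) (by simpa using hatom)
  simp only [ProbabilityMeasure.coe_mk, Measure.map_id] at h
  have h' := (ENNReal.tendsto_toReal (measure_ne_top _ _)).comp h
  have hlim : (chiSquared 2).real (Set.Ioi γ) = Real.exp (-γ / 2) := by
    rw [chiSquared_two_eq_expMeasure, expMeasure_real_Ioi (by norm_num) hγ]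
    congr 1
    ring
  rw [← hlim]
  refine h'.congr fun n => ?_
  rw [Function.comp_apply,
    Measure.map_apply_of_aemeasurable (hT.forall_aemeasurable n) measurableSet_Ioi]
  rfl

end OneBitRadar

end

theorem mainTheorem5 {p m : ℕ}
    -- known noise covariance, steering vectors, and the probing signal of each length `n`
    (K : Matrix (Fin m) (Fin m) ℂ) (hK : K.PosDef)
    (ar : Fin m → ℂ) (at' : Fin p → ℂ) (S : (n : ℕ) → Matrix (Fin p) (Fin n) ℂ)
    -- eventually `W ≠ 0`, and no single snapshot keeps a fixed fraction of the signal energy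
    (hW_ne : ∀ᶠ n in atTop, OneBitRadar.response ar at' (S n) ≠ 0)
    (hW : ∀ ε : ℝ, 0 < ε → ∀ᶠ n in atTop, ∀ i : Fin n,
      OneBitRadar.energy (OneBitRadar.response ar at' (S n)) i ≤
        ε * ∑ k, OneBitRadar.energy (OneBitRadar.response ar at' (S n)) k)
    -- the noise matrices: i.i.d. columns with distribution `𝒞𝒩(0, K)`
    {Ω : ℕ → Type*} [∀ n, MeasurableSpace (Ω n)] (P : (n : ℕ) → Measure (Ω n))
    [∀ n, IsProbabilityMeasure (P n)]
    (N : (n : ℕ) → Ω n → Matrix (Fin m) (Fin n) ℂ)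
    (hN_indep : ∀ n, iIndepFun (fun (i : Fin n) ω => (N n ω).col i) (P n))
    (hN_law : ∀ n, ∀ i : Fin n,
      OneBitRadar.IsCircularGaussian (fun ω => (N n ω).col i) K (P n))
    -- Rao's statistic of the one-bit data `Y = 𝒬(N)` received under the null hypothesis
    (T : (n : ℕ) → Ω n → ℝ)
    (hT : ∀ n ω, T n ω = OneBitRadar.raoStatistic K (OneBitRadar.response ar at' (S n))
      (OneBitRadar.quantize (N n ω))) :
    TendstoInDistribution T atTop id P (OneBitRadar.chiSquared 2) ∧
    OneBitRadar.chiSquared 2 = expMeasure (1 / 2) ∧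
    (∀ γ : ℝ, 0 ≤ γ →
      Tendsto (fun n => (P n).real {ω | γ < T n ω}) atTop (𝓝 (Real.exp (-γ / 2)))) ∧
    (∀ Pfa : ℝ, 0 < Pfa → Pfa ≤ 1 → ∀ γ : ℝ, 0 ≤ γ →
      (Tendsto (fun n => (P n).real {ω | γ < T n ω}) atTop (𝓝 Pfa) ↔
        γ = -2 * Real.log Pfa)) := by

  have hconv : TendstoInDistribution T atTop id P (OneBitRadar.chiSquared 2) := by
    have h := OneBitRadar.tendstoInDistribution_raoStatistic hK
      (fun n => OneBitRadar.response ar at' (S n)) hW_ne hW P N hN_indep hN_law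
    rwa [show T = fun n ω => OneBitRadar.raoStatistic K (OneBitRadar.response ar at' (S n))
      (OneBitRadar.quantize (N n ω)) from funext fun n => funext (hT n)]
  have hfa := fun (γ : ℝ) (hγ : 0 ≤ γ) =>
    OneBitRadar.tendsto_measureReal_Ioi_of_tendstoInDistribution hconv hγ
  refine ⟨hconv, OneBitRadar.chiSquared_two_eq_expMeasure, hfa, fun Pfa h0 _ γ hγ => ?_⟩
  constructor
  · intro h
    rw [tendsto_nhds_unique h (hfa γ hγ), Real.log_exp]
    ring
  · intro h
    have := hfa γ hγ
    rwa [show -γ / 2 = Real.log Pfa by rw [h]; ring, Real.exp_log h0] at this
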